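/- Let $n>2$. Let $\widetilde S_n$ be the affine symmetric group: the permutations $\phi$ of $\mathbb Z$ with $\phi(m+n)=\phi(m)+n$ for all $m$ and $\sum_{r=0}^{n-1}\phi(r)=\binom n2$. It is generated by $s_0,\dots,s_{n-1}$, where $s_r$ exchanges $r-1+nq$ and $r+nq$ for every $q\in\mathbb Z$. The $n$-window of $\phi$ is $(\phi(0),\dots,\phi(n-1))$, with entries numbered $1,\dots,n$. Let $f_n:\widetilde S_n\to S_n$ be the homomorphism that sends $s_r$ to the transposition $(r,r+1)$ for $1\le r\le n-1$ and $s_0$ to the transposition $(1,n)$. Let $V=\{a\in\mathbb R^n:\sum_r a_r=0\}$. The group $\widetilde S_n$ acts on $V$: for $1\le r\le n-1$, $s_r$ exchanges the coordinates $a_r$ and $a_{r+1}$, and $s_0(a_1,\dots,a_n)=(a_n+1,a_2,\dots,a_{n-1},a_1-1)$. For $\alpha=\epsilon_i-\epsilon_j$ and $k\in\mathbb Z$ let $H_{\alpha,k}=\{v\in V:\langle v,\alpha\rangle=k\}$, with closed half-spaces $H^+_{\alpha,k}=\{v\in V:\langle v,\alpha\rangle\ge k\}$ and $H^-_{\alpha,k}=\{v\in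 V:\langle v,\alpha\rangle\le k\}$. The dominant chamber is $\{a\in V:a_1\ge a_2\ge\dots\ge a_n\}$, and $A_0$ is its intersection with $H^-_{\epsilon_1-\epsilon_n,1}$. A wall of an alcove $wA_0$ ($w\in\widetilde S_n$) is a hyperplane $H_{\alpha,k}$ that contains a facet (a face of codimension one) of $wA_0$. The group $\widetilde S_n$ also acts on $n$-core partitions: $s_r$ adds all addable boxes of content (column minus row) congruent to $r$ mod $n$ if there are any, otherwise it removes all removable boxes of content congruent to $r$ mod $n$. The positive abacus of a partition $\lambda$ is the set of all negative integers together with the hook lengths of the boxes in the first column of $\lambda$. Exactly one translate $B$ of it is balanced, which means that $a_1+\dots+a_n=0$, where $na_{r+1}+r$ is the least integer congruent to $r$ mod $n$ that is not in $B$ ($0\le r\le n-1$). For this translate put $S(\lambda)_r=na_{r+1}+r$; the $n$-set of $\lambda$ is $S(\lambda)=\{S(\lambda)_0,\dots,S(\lambda)_{n-1}\}$. Let $wA_0$ be a dominant alcove (that is, contained in the dominant chamber) with $wA_0\subseteq H_{\alpha,k}^+\cap H_{\alpha,k+1}^-$, where $\alpha=\epsilon_i-\epsilon_j$, $1\le i<j\le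 n$ and $k\in\mathbb Z$. Let $X=(X_1,\dots,X_n)$ be the $n$-window of $w^{-1}$, let $\lambda=w^{-1}\emptyset$ and let $\sigma=f_n(w)$. Then: (i) $nk<X_j-X_i<n(k+1)$; (ii) $X_j-X_i=nk+1$ if and only if $H_{\alpha,k}$ is a wall of $wA_0$; (iii) $X_j-X_i=n(k+1)-1$ if and only if $H_{\alpha,k+1}$ is a wall of $wA_0$; (iv) $S(\lambda)_{j-1}-S(\lambda)_{i-1}=X_{\sigma(j)}-X_{\sigma(i)}$; in particular the absolute values of the two differences agree. -/

import Mathlib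

namespace AffineCore

/-! ## The affine symmetric group -/

/-- The affine symmetric group: permutations `φ` of `ℤ` with `φ (m + n) = φ m + n` for all `m`
and `φ 0 + ⋯ + φ (n - 1) = 0 + ⋯ + (n - 1)`. -/
def IsAffinePerm (n : ℕ) (φ : Equiv.Perm ℤ) : Prop :=
  (∀ m : ℤ, φ (m + n) = φ m + n) ∧ ∑ i : Fin n, φ (i : ℤ) = ∑ i : Fin n, (i : ℤ)

instance instNeZero (n : ℕ) [h : Fact (2 < n)] : NeZero n := ⟨by have := h.out; omega⟩

/-- The residue of an integer modulo `n`, as an element of `Fin n = {0, …, n - 1}`. -/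
def res (n : ℕ) [NeZero n] (x : ℤ) : Fin n :=
  ⟨(x % (n : ℤ)).toNat, by
    have hn : (0 : ℤ) < n := by exact_mod_cast Nat.pos_of_ne_zero (NeZero.ne n)
    have h1 := Int.emod_nonneg x hn.ne'
    have h2 := Int.emod_lt_of_pos x hn
    omega⟩

theorem res_val (n : ℕ) [NeZero n] (x : ℤ) : ((res n x : ℕ) : ℤ) = x % n := by
  have hn : (n : ℤ) ≠ 0 := by exact_mod_cast NeZero.ne n
  simp [res, Int.toNat_of_nonneg (Int.emod_nonneg x hn)]

theorem res_eq_iff (n : ℕ) [NeZero n] (x y : ℤ) : res n x = res n y ↔ x % n = y % n := by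
  rw [← res_val, ← res_val, Fin.ext_iff, Nat.cast_inj]

theorem res_coe (n : ℕ) [NeZero n] (i : Fin n) : res n ((i : ℕ) : ℤ) = i := by
  have h := res_val n ((i : ℕ) : ℤ)
  rw [Int.emod_eq_of_lt (by omega) (by exact_mod_cast i.isLt)] at h
  exact Fin.ext (by exact_mod_cast h)

theorem apply_add_mul {n : ℕ} {φ : ℤ → ℤ} (h : ∀ m : ℤ, φ (m + n) = φ m + n) (x q : ℤ) :
    φ (x + n * q) = φ x + n * q := by
  have hp : Function.Periodic (fun x => φ x - x) (n : ℤ) := fun x => by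
    have := h x
    simp only [this]; ring
  have := (hp.int_mul q) x
  rw [mul_comm, Int.cast_id] at this
  linarith

theorem apply_emod {n : ℕ} {φ : ℤ → ℤ} (h : ∀ m : ℤ, φ (m + n) = φ m + n) (x : ℤ) :
    φ x = φ (x % n) + n * (x / n) := by
  rw [← apply_add_mul h, Int.emod_add_mul_ediv]

theorem symm_apply_add {n : ℕ} {φ : Equiv.Perm ℤ} (h : ∀ m : ℤ, φ (m + n) = φ m + n) (m : ℤ) :
    φ.symm (m + n) = φ.symm m + n := by
  rw [Equiv.symm_apply_eq, h, Equiv.apply_symm_apply]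

/-- The permutation of the residues modulo `n` induced by a periodic permutation of `ℤ`. -/
def resPerm (n : ℕ) [NeZero n] (φ : Equiv.Perm ℤ) (h : ∀ m : ℤ, φ (m + n) = φ m + n) :
    Equiv.Perm (Fin n) where
  toFun i := res n (φ (i : ℕ))
  invFun i := res n (φ.symm (i : ℕ))
  left_inv i := by
    conv_rhs => rw [← res_coe n i]
    rw [res_eq_iff, res_val]
    have := apply_emod (symm_apply_add h) (φ ((i : ℕ) : ℤ))
    rw [Equiv.symm_apply_apply] at this
    conv_rhs => rw [this]
    simp
  right_inv i := by
    conv_rhs => rw [← res_coe n i]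
    rw [res_eq_iff, res_val]
    have := apply_emod h (φ.symm ((i : ℕ) : ℤ))
    rw [Equiv.apply_symm_apply] at this
    conv_rhs => rw [this]
    simp

theorem periodic_res {M : Type*} {n : ℕ} [NeZero n] {g : ℤ → M}
    (hg : Function.Periodic g (n : ℤ)) (x : ℤ) : g ((res n x : ℕ) : ℤ) = g x := by
  rw [res_val]
  have := (hg.int_mul (x / n)) (x % n)
  rw [← this, mul_comm, Int.cast_id, Int.emod_add_mul_ediv]

theorem sum_periodic_comp {M : Type*} [AddCommMonoid M] {n : ℕ} [NeZero n] {g : ℤ → M}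
    (hg : Function.Periodic g (n : ℤ)) (φ : Equiv.Perm ℤ) (h : ∀ m : ℤ, φ (m + n) = φ m + n) :
    ∑ i : Fin n, g (φ (i : ℕ)) = ∑ i : Fin n, g ((i : ℕ) : ℤ) := by
  rw [← Equiv.sum_comp (resPerm n φ h) (fun i : Fin n => g ((i : ℕ) : ℤ))]
  exact Finset.sum_congr rfl fun i _ => (periodic_res hg _).symm

theorem IsAffinePerm.periodic_sub {n : ℕ} {φ : Equiv.Perm ℤ} (h : IsAffinePerm n φ) :
    Function.Periodic (fun x => φ x - x) (n : ℤ) := fun x => by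
  simp only [h.1]; ring

/-- The affine symmetric group, as a group of permutations of `ℤ` under composition. -/
def affineSymm (n : ℕ) [NeZero n] : Subgroup (Equiv.Perm ℤ) where
  carrier := {φ | IsAffinePerm n φ}
  one_mem' := ⟨fun _ => rfl, rfl⟩
  mul_mem' := by
    intro φ ψ hφ hψ
    refine ⟨fun m => by simp [hφ.1, hψ.1], ?_⟩
    have h1 := sum_periodic_comp hφ.periodic_sub ψ hψ.1
    have h2 := hφ.2
    have h3 := hψ.2
    simp only [Finset.sum_sub_distrib] at h1
    simp only [Equiv.Perm.mul_apply]
    linarith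
  inv_mem' := by
    intro φ hφ
    have hs := symm_apply_add hφ.1
    refine ⟨hs, ?_⟩
    have h1 := sum_periodic_comp hφ.periodic_sub φ.symm hs
    have h2 := hφ.2
    simp only [Finset.sum_sub_distrib, Equiv.apply_symm_apply] at h1
    change ∑ i : Fin n, φ.symm ((i : ℕ) : ℤ) = _
    linarith

theorem affineSymm_add {n : ℕ} [NeZero n] (w : affineSymm n) (m : ℤ) :
    w.1 (m + n) = w.1 m + n := w.2.1 m

/-- The `n`-window `(φ 0, …, φ (n - 1))`. The `p`-th entry of an `n`-tuple, `1 ≤ p ≤ n`, has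
index `p - 1` in `Fin n`; this shift of indices is used throughout. -/
def window {n : ℕ} [NeZero n] (w : affineSymm n) (i : Fin n) : ℤ := w.1 ((i : ℕ) : ℤ)

/-- The underlying map of the generator `s_i`: it exchanges `i - 1 + n q` and `i + n q`
for every integer `q`. -/
def sMap (n : ℕ) (i : Fin n) (x : ℤ) : ℤ :=
  if x % n = ((i : ℕ) : ℤ) then x - 1 else if (x + 1) % n = ((i : ℕ) : ℤ) then x + 1 else x

theorem emod_add_one_ne {n : ℕ} [h : Fact (2 < n)] (x : ℤ) : (x + 1) % n ≠ x % n := by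
  intro e
  have hn := h.out
  have h2 : (n : ℤ) ∣ (x + 1) - x :=
    Int.dvd_of_emod_eq_zero (Int.emod_eq_emod_iff_emod_sub_eq_zero.1 e)
  have := Int.le_of_dvd (by omega) h2
  omega

theorem sMap_sMap {n : ℕ} [h : Fact (2 < n)] (i : Fin n) (x : ℤ) :
    sMap n i (sMap n i x) = x := by
  have k1 := emod_add_one_ne (n := n) x
  have k2 := emod_add_one_ne (n := n) (x - 1)
  rw [sub_add_cancel] at k2
  unfold sMap
  split_ifs <;> simp_all

theorem sMap_eq {n : ℕ} [h : Fact (2 < n)] (i : Fin n) (x : ℤ) :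
    sMap n i x - x = (if (x + 1) % n = ((i : ℕ) : ℤ) then 1 else 0)
      - (if x % n = ((i : ℕ) : ℤ) then 1 else 0) := by
  have k1 := emod_add_one_ne (n := n) x
  unfold sMap
  split_ifs <;> simp_all

theorem sMap_add (n : ℕ) (i : Fin n) (x : ℤ) : sMap n i (x + n) = sMap n i x + n := by
  have e : (x + n + 1) % (n : ℤ) = (x + 1) % n := by
    rw [add_right_comm, Int.add_emod_right]
  simp only [sMap, Int.add_emod_right, e]
  split_ifs <;> ring

/-- The generators `s_0, …, s_{n-1}`. -/
def s {n : ℕ} [h : Fact (2 < n)] (i : Fin n) : affineSymm n :=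
  ⟨⟨sMap n i, sMap n i, sMap_sMap i, sMap_sMap i⟩, sMap_add n i, by
    have hp : Function.Periodic (fun x : ℤ => if x % n = ((i : ℕ) : ℤ) then (1 : ℤ) else 0) (n : ℤ) :=
      fun x => by simp only [Int.add_emod_right]
    have h1 : ∑ j : Fin n, (if (((j : ℕ) : ℤ) + 1) % n = ((i : ℕ) : ℤ) then (1 : ℤ) else 0)
        = ∑ j : Fin n, (if ((j : ℕ) : ℤ) % n = ((i : ℕ) : ℤ) then (1 : ℤ) else 0) :=
      sum_periodic_comp hp (Equiv.addRight 1) (fun m => by simp; ring)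
    have h2 : ∑ j : Fin n, (sMap n i ((j : ℕ) : ℤ) - ((j : ℕ) : ℤ)) = 0 := by
      simp only [sMap_eq, Finset.sum_sub_distrib]
      rw [h1, sub_self]
    rw [Finset.sum_sub_distrib] at h2
    simp only [Equiv.coe_fn_mk]
    linarith⟩

theorem s_apply {n : ℕ} [h : Fact (2 < n)] (i : Fin n) (x : ℤ) : (s i).1 x = sMap n i x := rfl

/-- The descent used to show that the `s_i` generate. -/
def dispSq {n : ℕ} [NeZero n] (w : affineSymm n) : ℤ := ∑ i : Fin n, (w.1 (i : ℕ) - (i : ℕ)) ^ 2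

theorem dispSq_mul_s {n : ℕ} [h : Fact (2 < n)] (w : affineSymm n) (x : ℤ)
    (hx : w.1 (x + 1) < w.1 x) : dispSq (w * s (res n (x + 1))) < dispSq w := by
  set i := res n (x + 1) with hi
  have hiv : (((i : Fin n) : ℕ) : ℤ) = (x + 1) % n := res_val n (x + 1)
  have hw := w.2.1
  have hg : Function.Periodic (fun z : ℤ => (w.1 z - sMap n i z) ^ 2) (n : ℤ) := fun z => by
    simp only [hw, sMap_add]; ring
  have e1 := sum_periodic_comp hg (s i).1 (s i).2.1
  have e2 : dispSq (w * s i) = ∑ z : Fin n, (w.1 (z : ℕ) - sMap n i (z : ℕ)) ^ 2 := by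
    rw [← e1]
    refine Finset.sum_congr rfl fun z _ => ?_
    simp only [s_apply, sMap_sMap]
    rfl
  have hp : Function.Periodic (fun z : ℤ => if z % n = ((i : ℕ) : ℤ)
      then 2 * (w.1 z - z) + 1 else 0) (n : ℤ) := fun z => by
    simp only [Int.add_emod_right, hw]
    congr 1; ring
  have e3 : (∑ z : Fin n, if (((z : ℕ) : ℤ) + 1) % n = ((i : ℕ) : ℤ)
      then 2 * (w.1 ((z : ℕ) + 1) - ((z : ℕ) + 1)) + 1 else 0)
      = ∑ z : Fin n, if ((z : ℕ) : ℤ) % n = ((i : ℕ) : ℤ)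
        then 2 * (w.1 (z : ℕ) - (z : ℕ)) + 1 else 0 :=
    sum_periodic_comp hp (Equiv.addRight 1) (fun m => by simp; ring)
  have e4 : dispSq w - dispSq (w * s i) = ∑ z : Fin n,
      if (((z : ℕ) : ℤ) + 1) % n = ((i : ℕ) : ℤ)
        then 2 * (w.1 ((z : ℕ) : ℤ) - w.1 ((z : ℕ) + 1)) else 0 := by
    have e5 : dispSq w - dispSq (w * s i) = (∑ z : Fin n,
        if (((z : ℕ) : ℤ) + 1) % n = ((i : ℕ) : ℤ) then 2 * (w.1 (z : ℕ) - (z : ℕ)) - 1 else 0)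
        - ∑ z : Fin n, if ((z : ℕ) : ℤ) % n = ((i : ℕ) : ℤ)
          then 2 * (w.1 (z : ℕ) - (z : ℕ)) + 1 else 0 := by
      rw [e2, dispSq, ← Finset.sum_sub_distrib, ← Finset.sum_sub_distrib]
      refine Finset.sum_congr rfl fun z _ => ?_
      have k1 := emod_add_one_ne (n := n) ((z : ℕ) : ℤ)
      have k2 := sMap_eq i ((z : ℕ) : ℤ)
      have k3 : sMap n i ((z : ℕ) : ℤ) = ((z : ℕ) : ℤ)
        + (sMap n i ((z : ℕ) : ℤ) - ((z : ℕ) : ℤ)) := by ring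
      rw [k3, k2]
      split_ifs with c1 c2 c2
      · exact absurd (c1.trans c2.symm) k1
      · ring
      · ring
      · ring
    rw [e5]
    rw [sub_eq_iff_eq_add, ← e3, ← Finset.sum_add_distrib]
    refine Finset.sum_congr rfl fun z _ => ?_
    split_ifs <;> ring
  have hper : Function.Periodic (fun z : ℤ => w.1 z - w.1 (z + 1)) (n : ℤ) := fun z => by
    simp only [hw, add_right_comm z (n : ℤ) 1]; ring
  have hd : ∀ z : ℤ, (z + 1) % n = (x + 1) % n → 0 < w.1 z - w.1 (z + 1) := by
    intro z hz
    have : res n z = res n x := by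
      rw [res_eq_iff]
      have := Int.ModEq.add_right_cancel' 1 (show z + 1 ≡ x + 1 [ZMOD n] from hz)
      exact this
    have h1 := periodic_res hper z
    rw [this, periodic_res hper x] at h1
    omega
  have : 0 < dispSq w - dispSq (w * s i) := by
    rw [e4]
    refine Finset.sum_pos' (fun z _ => ?_) ⟨res n x, Finset.mem_univ _, ?_⟩
    · split_ifs with c
      · have := hd _ (c.trans hiv); omega
      · exact le_rfl
    · have c : (((res n x : Fin n) : ℕ) + 1 : ℤ) % n = (x + 1) % n := by
        rw [res_val]; simp
      rw [if_pos (c.trans hiv.symm)]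
      have := hd _ c; omega
  omega

/-- Every element of the affine symmetric group is a product of the generators `s_i`. -/
theorem exists_word {n : ℕ} [h : Fact (2 < n)] (w : affineSymm n) :
    ∃ l : List (Fin n), (l.map s).prod = w := by
  have hn : (0 : ℤ) < n := by have := h.out; omega
  have hnn : ∀ u : affineSymm n, 0 ≤ dispSq u := fun u => Finset.sum_nonneg fun _ _ => sq_nonneg _
  induction hk : (dispSq w).toNat using Nat.strong_induction_on generalizing w with
  | _ k ih =>
    by_cases hx : ∃ x, w.1 (x + 1) < w.1 x
    · obtain ⟨x, hx⟩ := hx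
      have h1 := dispSq_mul_s w x hx
      have h2 := hnn (w * s (res n (x + 1)))
      obtain ⟨l, hl⟩ := ih _ (by omega) (w * s (res n (x + 1))) rfl
      refine ⟨l ++ [res n (x + 1)], ?_⟩
      have h3 : s (res n (x + 1)) * s (res n (x + 1)) = 1 := by
        ext y
        exact sMap_sMap _ y
      simp [hl, mul_assoc, h3]
    · push Not at hx
      refine ⟨[], ?_⟩
      have hp := IsAffinePerm.periodic_sub w.2
      have hge : ∀ x, 0 ≤ (w.1 (x + 1) - (x + 1)) - (w.1 x - x) := by
        intro x
        have h1 := hx x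
        have h2 : w.1 x ≠ w.1 (x + 1) := fun e => by
          have := w.1.injective e; omega
        omega
      have hs := sum_periodic_comp hp (Equiv.addRight 1) (fun m => by simp; ring)
      simp only [Equiv.coe_addRight] at hs
      have h0 : ∑ i : Fin n, ((w.1 ((i : ℕ) + 1) - ((i : ℕ) + 1)) - (w.1 (i : ℕ) - (i : ℕ))) = 0 := by
        rw [Finset.sum_sub_distrib, hs, sub_self]
      rw [Finset.sum_eq_zero_iff_of_nonneg (fun i _ => hge _)] at h0
      have hq : Function.Periodic (fun x => (w.1 (x + 1) - (x + 1)) - (w.1 x - x)) (n : ℤ) :=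
        fun x => by simp only [add_right_comm x (n : ℤ) 1, w.2.1]; ring
      have h1 : Function.Periodic (fun x => w.1 x - x) 1 := fun x => by
        have e := periodic_res hq x
        have := h0 (res n x) (Finset.mem_univ _)
        simp only at e ⊢
        omega
      have h2 : ∀ x, w.1 x - x = w.1 0 - 0 := fun x => by
        have := h1.int_mul x 0
        simpa using this
      have h3 := w.2.2
      have h4 : ∑ i : Fin n, (w.1 ((i : ℕ) : ℤ) - ((i : ℕ) : ℤ)) = n * (w.1 0 - 0) := by
        rw [Finset.sum_congr rfl fun i _ => h2 _]; simp
      rw [Finset.sum_sub_distrib, h3, sub_self] at h4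
      have h5 : w.1 0 - 0 = 0 := by
        rcases mul_eq_zero.1 h4.symm with h | h
        · omega
        · exact h
      ext x
      have := h2 x
      simp only [List.map_nil, List.prod_nil, OneMemClass.coe_one, Equiv.Perm.one_apply]
      omega

/-- The homomorphism `f_n` to the finite symmetric group: reduction modulo `n`. It is the
homomorphism with `s_0 ↦ s_θ` and `s_i ↦ s_i` for `1 ≤ i ≤ n - 1`, see `finPart_s` and
`finPart_s_zero`. -/
def finPart {n : ℕ} [NeZero n] : affineSymm n →* Equiv.Perm (Fin n) where
  toFun w := resPerm n w.1 w.2.1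
  map_one' := by
    ext i
    simp [resPerm, res_coe]
  map_mul' u v := by
    ext1 i
    change res n (u.1 (v.1 ((i : ℕ) : ℤ))) = res n (u.1 ((res n (v.1 ((i : ℕ) : ℤ)) : ℕ) : ℤ))
    rw [res_eq_iff, res_val, apply_emod u.2.1 (v.1 ((i : ℕ) : ℤ))]
    simp

theorem finPart_apply {n : ℕ} [NeZero n] (w : affineSymm n) (i : Fin n) :
    finPart w i = res n (w.1 ((i : ℕ) : ℤ)) := rfl

theorem finPart_s {n : ℕ} [h : Fact (2 < n)] (i j : Fin n) (hij : (i : ℕ) = j + 1) :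
    finPart (s i) = Equiv.swap j i := by
  have hn := h.out
  ext1 p
  have hp := p.isLt
  have hi := i.isLt
  rw [finPart_apply, Equiv.swap_apply_def]
  apply Fin.ext
  zify
  rw [res_val, s_apply]
  have e1 : ((p : ℕ) : ℤ) % n = (p : ℕ) := Int.emod_eq_of_lt (by omega) (by omega)
  simp only [Fin.ext_iff, apply_ite Fin.val, Nat.cast_ite]
  unfold sMap
  by_cases hpn : (p : ℕ) + 1 = n
  · have e2 : (((p : ℕ) : ℤ) + 1) % n = 0 := by
      rw [show ((p : ℕ) : ℤ) + 1 = n by omega, Int.emod_self]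
    rw [e1, e2]
    split_ifs <;> first | omega | (rw [Int.emod_eq_of_lt] <;> omega)
  · have e2 : (((p : ℕ) : ℤ) + 1) % n = (p : ℕ) + 1 := Int.emod_eq_of_lt (by omega) (by omega)
    rw [e1, e2]
    split_ifs <;> first | omega | (rw [Int.emod_eq_of_lt] <;> omega)

theorem finPart_s_zero {n : ℕ} [h : Fact (2 < n)] (i j : Fin n) (hi : (i : ℕ) = 0)
    (hj : (j : ℕ) = n - 1) : finPart (s i) = Equiv.swap i j := by
  have hn := h.out
  ext1 p
  have hp := p.isLt
  rw [finPart_apply, Equiv.swap_apply_def]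
  apply Fin.ext
  zify
  rw [res_val, s_apply]
  have e1 : ((p : ℕ) : ℤ) % n = (p : ℕ) := Int.emod_eq_of_lt (by omega) (by omega)
  simp only [Fin.ext_iff, apply_ite Fin.val, Nat.cast_ite]
  unfold sMap
  by_cases hpn : (p : ℕ) + 1 = n
  · have e2 : (((p : ℕ) : ℤ) + 1) % n = 0 := by
      rw [show ((p : ℕ) : ℤ) + 1 = n by omega, Int.emod_self]
    rw [e1, e2]
    split_ifs <;> omega
  · have e2 : (((p : ℕ) : ℤ) + 1) % n = (p : ℕ) + 1 := Int.emod_eq_of_lt (by omega) (by omega)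
    rw [e1, e2]
    split_ifs with c1 <;> first
      | omega
      | (rw [Int.emod_eq_of_lt] <;> omega)
      | (rw [← Int.add_emod_right, Int.emod_eq_of_lt] <;> omega)

/-! ## Roots, hyperplanes and alcoves -/

/-- The space `V` of vectors in `ℝⁿ` with coordinate sum zero. -/
def V (n : ℕ) : Submodule ℝ (EuclideanSpace ℝ (Fin n)) where
  carrier := {v | ∑ i, v i = 0}
  zero_mem' := by simp
  add_mem' := by
    intro a b ha hb
    simp only [Set.mem_ofPred_eq, PiLp.add_apply, Finset.sum_add_distrib] at *
    rw [ha, hb, add_zero]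
  smul_mem' := by
    intro c a ha
    simp only [Set.mem_ofPred_eq, PiLp.smul_apply, smul_eq_mul, ← Finset.mul_sum] at *
    rw [ha, mul_zero]

/-- The root `ε_i - ε_j`. -/
noncomputable def root {n : ℕ} (i j : Fin n) : EuclideanSpace ℝ (Fin n) :=
  EuclideanSpace.single i 1 - EuclideanSpace.single j 1

/-- The hyperplane `H_{α,k}` of `V`. -/
def hyperplane {n : ℕ} (α : EuclideanSpace ℝ (Fin n)) (k : ℤ) : Set (EuclideanSpace ℝ (Fin n)) :=
  {v | v ∈ V n ∧ inner ℝ v α = (k : ℝ)}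

/-- The closed half space `H_{α,k}^+` of `V`. -/
def halfPos {n : ℕ} (α : EuclideanSpace ℝ (Fin n)) (k : ℤ) : Set (EuclideanSpace ℝ (Fin n)) :=
  {v | v ∈ V n ∧ (k : ℝ) ≤ inner ℝ v α}

/-- The closed half space `H_{α,k}^-` of `V`. -/
def halfNeg {n : ℕ} (α : EuclideanSpace ℝ (Fin n)) (k : ℤ) : Set (EuclideanSpace ℝ (Fin n)) :=
  {v | v ∈ V n ∧ inner ℝ v α ≤ (k : ℝ)}

/-- The dominant chamber: the intersection of the half spaces `H_{α,0}^+` over the simple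
roots `α = ε_i - ε_{i+1}`. -/
def dominantChamber (n : ℕ) : Set (EuclideanSpace ℝ (Fin n)) :=
  {v | v ∈ V n ∧ ∀ i j : Fin n, (j : ℕ) = i + 1 → v ∈ halfPos (root i j) 0}

/-- The fundamental alcove `A₀`: the part of the dominant chamber in `H_{θ,1}^-`, where
`θ = ε_1 - ε_n`. -/
def fundamentalAlcove (n : ℕ) [NeZero n] : Set (EuclideanSpace ℝ (Fin n)) :=
  dominantChamber n ∩ halfNeg (root (res n 0) (res n (-1))) 1

/-- The extension of `v` to all integer indices with `v_{x+n} = v_x - 1`. -/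
noncomputable def extend {n : ℕ} [NeZero n] (v : EuclideanSpace ℝ (Fin n)) (x : ℤ) : ℝ :=
  v (res n x) - ((x / n : ℤ) : ℝ)

/-- The action of the affine symmetric group on `ℝⁿ`, preserving `V`, in which `s_i` exchanges
the `i`-th and `(i+1)`-st coordinates for `1 ≤ i ≤ n - 1`, and
`s_0 (a_1, …, a_n) = (a_n + 1, a_2, …, a_{n-1}, a_1 - 1)`. See `act_one`, `act_mul`, `act_mem_V`,
`act_s` and `act_s_zero`. -/
noncomputable def act {n : ℕ} [NeZero n] (w : affineSymm n) (v : EuclideanSpace ℝ (Fin n)) :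
    EuclideanSpace ℝ (Fin n) :=
  WithLp.toLp 2 fun j => extend v (w.1.symm ((j : ℕ) : ℤ))

theorem extend_coe {n : ℕ} [NeZero n] (v : EuclideanSpace ℝ (Fin n)) (j : Fin n) :
    extend v ((j : ℕ) : ℤ) = v j := by
  have : (((j : ℕ) : ℤ) / n) = 0 := Int.ediv_eq_zero_of_lt (by omega) (by exact_mod_cast j.isLt)
  simp [extend, res_coe, this]

theorem extend_add_mul {n : ℕ} [NeZero n] (v : EuclideanSpace ℝ (Fin n)) (x q : ℤ) :
    extend v (x + n * q) = extend v x - q := by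
  have hn : (n : ℤ) ≠ 0 := by exact_mod_cast NeZero.ne n
  have h1 : res n (x + n * q) = res n x := by rw [res_eq_iff]; simp
  rw [extend, extend, h1, Int.add_mul_ediv_left _ _ hn]
  push_cast; ring

theorem extend_act {n : ℕ} [NeZero n] (w : affineSymm n) (v : EuclideanSpace ℝ (Fin n)) (x : ℤ) :
    extend (act w v) x = extend v (w.1.symm x) := by
  rw [extend, act]
  simp only [res_val]
  rw [apply_emod (symm_apply_add w.2.1) x, extend_add_mul]

theorem act_one {n : ℕ} [NeZero n] (v : EuclideanSpace ℝ (Fin n)) : act 1 v = v := by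
  ext j
  exact extend_coe v j

theorem act_mul {n : ℕ} [NeZero n] (u w : affineSymm n) (v : EuclideanSpace ℝ (Fin n)) :
    act (u * w) v = act u (act w v) := by
  ext j
  have h1 := extend_act w v (u.1.symm ((j : ℕ) : ℤ))
  exact h1.symm

theorem act_mem_V {n : ℕ} [NeZero n] (w : affineSymm n) (v : EuclideanSpace ℝ (Fin n))
    (hv : v ∈ V n) : act w v ∈ V n := by
  have hn : (n : ℤ) ≠ 0 := by exact_mod_cast NeZero.ne n
  have hs := symm_apply_add w.2.1
  have hg : Function.Periodic (fun x => extend v x + (x : ℝ) / n) (n : ℤ) := fun x => by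
    have h1 := extend_add_mul v x 1
    have hn' : (n : ℝ) ≠ 0 := by exact_mod_cast hn
    rw [mul_one] at h1
    simp only [h1]
    push_cast
    field_simp
    ring
  have h1 := sum_periodic_comp hg w.1.symm hs
  have h2 : ∑ i : Fin n, w.1.symm ((i : ℕ) : ℤ) = ∑ i : Fin n, ((i : ℕ) : ℤ) := (w⁻¹).2.2
  have h3 : ∑ i : Fin n, ((w.1.symm ((i : ℕ) : ℤ) : ℤ) : ℝ) = ∑ i : Fin n, (((i : ℕ) : ℤ) : ℝ) := by
    exact_mod_cast h2
  simp only [Finset.sum_add_distrib, ← Finset.sum_div, h3, extend_coe] at h1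
  have hv' : ∑ i, v i = 0 := hv
  change ∑ i : Fin n, extend v (w.1.symm ((i : ℕ) : ℤ)) = 0
  linarith

theorem act_s_apply {n : ℕ} [h : Fact (2 < n)] (i p : Fin n)
    (v : EuclideanSpace ℝ (Fin n)) : act (s i) v p = extend v (sMap n i ((p : ℕ) : ℤ)) := rfl

theorem act_s {n : ℕ} [h : Fact (2 < n)] (i j : Fin n) (hij : (i : ℕ) = j + 1)
    (v : EuclideanSpace ℝ (Fin n)) (p : Fin n) : act (s i) v p = v (Equiv.swap j i p) := by
  have h0 : finPart (s i) p = Equiv.swap j i p := by rw [finPart_s i j hij]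
  rw [finPart_apply] at h0
  rw [act_s_apply, extend, ← s_apply, h0]
  have hp := p.isLt
  have hi := i.isLt
  have e1 : ((p : ℕ) : ℤ) % n = (p : ℕ) := Int.emod_eq_of_lt (by omega) (by omega)
  have : (s i).1 ((p : ℕ) : ℤ) / n = 0 := by
    rw [s_apply]
    unfold sMap
    rw [e1]
    by_cases hpn : (p : ℕ) + 1 = n
    · have e2 : (((p : ℕ) : ℤ) + 1) % n = 0 := by
        rw [show ((p : ℕ) : ℤ) + 1 = n by omega, Int.emod_self]
      rw [e2]
      split_ifs <;> (apply Int.ediv_eq_zero_of_lt <;> omega)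
    · split_ifs <;> (apply Int.ediv_eq_zero_of_lt <;> omega)
  rw [this]; simp

theorem act_s_zero {n : ℕ} [h : Fact (2 < n)] (i j : Fin n) (hi : (i : ℕ) = 0)
    (hj : (j : ℕ) = n - 1) (v : EuclideanSpace ℝ (Fin n)) (p : Fin n) :
    act (s i) v p = if p = i then v j + 1 else if p = j then v i - 1 else v p := by
  have hn := h.out
  have h0 : finPart (s i) p = Equiv.swap i j p := by rw [finPart_s_zero i j hi hj]
  rw [finPart_apply] at h0
  rw [act_s_apply, extend, ← s_apply, h0, Equiv.swap_apply_def]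
  have hp := p.isLt
  have e1 : ((p : ℕ) : ℤ) % n = (p : ℕ) := Int.emod_eq_of_lt (by omega) (by omega)
  have e2 : (p : ℕ) + 1 ≠ n → (((p : ℕ) : ℤ) + 1) % n = (p : ℕ) + 1 := fun hne =>
    Int.emod_eq_of_lt (by omega) (by omega)
  have e3 : (p : ℕ) + 1 = n → (((p : ℕ) : ℤ) + 1) % n = 0 := fun he => by
    rw [show ((p : ℕ) : ℤ) + 1 = n by omega, Int.emod_self]
  rw [s_apply]
  unfold sMap
  rw [e1]
  by_cases c1 : p = i
  · have hp0 : (p : ℕ) = 0 := by rw [c1, hi]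
    have : (((p : ℕ) : ℤ) - 1) / n = -1 := by
      rw [hp0]
      exact Int.ediv_eq_neg_one_of_neg_of_le (by omega) (by omega)
    rw [if_pos c1, if_pos c1, if_pos (by rw [c1]), this]
    simp
  · have hp0 : (p : ℕ) ≠ 0 := fun e => c1 (Fin.ext (e.trans hi.symm))
    rw [if_neg c1, if_neg c1,
      if_neg (show ¬ ((p : ℕ) : ℤ) = ((i : ℕ) : ℤ) by omega)]
    by_cases c2 : p = j
    · have hpn : (p : ℕ) + 1 = n := by rw [c2, hj]; omega
      rw [if_pos c2, if_pos c2, if_pos (by rw [e3 hpn, hi]; rfl),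
        show ((p : ℕ) : ℤ) + 1 = n by omega, Int.ediv_self (by omega)]
      simp
    · have hpn : (p : ℕ) + 1 ≠ n := fun e => c2 (Fin.ext (by omega))
      rw [if_neg c2, if_neg c2, if_neg (by rw [e2 hpn, hi]; omega),
        Int.ediv_eq_zero_of_lt (by omega) (by omega)]
      simp

/-- The alcove `w A₀`. -/
def alcove {n : ℕ} [NeZero n] (w : affineSymm n) : Set (EuclideanSpace ℝ (Fin n)) :=
  act w '' fundamentalAlcove n

/-- `H_{α,k}` is a wall of `A`: the set `A` lies on one side of `H_{α,k}`, and `A ∩ H_{α,k}` is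
a facet of `A`, that is, it has the dimension of `H_{α,k}`. -/
def IsWall {n : ℕ} (A : Set (EuclideanSpace ℝ (Fin n))) (α : EuclideanSpace ℝ (Fin n)) (k : ℤ) :
    Prop :=
  (A ⊆ halfPos α k ∨ A ⊆ halfNeg α k) ∧
    (affineSpan ℝ (A ∩ hyperplane α k) : Set (EuclideanSpace ℝ (Fin n))) = hyperplane α k

/-! ## Partitions, their abaci and `n`-sets -/

/-- The box `c` is addable for the partition `μ`. -/
def Addable (μ : YoungDiagram) (c : ℕ × ℕ) : Prop :=
  c ∉ μ ∧ IsLowerSet (insert c (μ.cells : Set (ℕ × ℕ)))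

/-- The box `c` is removable for the partition `μ`. -/
def Removable (μ : YoungDiagram) (c : ℕ × ℕ) : Prop :=
  c ∈ μ ∧ IsLowerSet ((μ.cells : Set (ℕ × ℕ)) \ {c})

/-- The content, column minus row, of the box in row `c.1` and column `c.2`. -/
def content (c : ℕ × ℕ) : ℤ := (c.2 : ℤ) - c.1

theorem finite_addable (μ : YoungDiagram) : {c | Addable μ c}.Finite := by
  refine Set.Finite.subset (Finset.finite_toSet (insert (0, 0)
    (μ.cells.image (fun c => (c.1 + 1, c.2)) ∪ μ.cells.image (fun c => (c.1, c.2 + 1))))) ?_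
  rintro ⟨a, b⟩ ⟨_, h2⟩
  simp only [Finset.coe_insert, Finset.coe_union, Finset.coe_image, Set.mem_insert_iff,
    Set.mem_union, Set.mem_image]
  rcases a with _ | a
  · rcases b with _ | b
    · exact Or.inl rfl
    · have := h2 (show ((0, b) : ℕ × ℕ) ≤ (0, b + 1) from ⟨le_rfl, Nat.le_succ b⟩)
        (Set.mem_insert _ _)
      rcases this with h | h
      · simp at h
      · exact Or.inr (Or.inr ⟨_, h, rfl⟩)
  · have := h2 (show ((a, b) : ℕ × ℕ) ≤ (a + 1, b) from ⟨Nat.le_succ a, le_rfl⟩)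
      (Set.mem_insert _ _)
    rcases this with h | h
    · simp at h
    · exact Or.inr (Or.inl ⟨_, h, rfl⟩)

open Classical in
/-- The partition `μ` together with all addable boxes of content `i` modulo `n`. -/
noncomputable def addBoxes {n : ℕ} [NeZero n] (i : Fin n) (μ : YoungDiagram) : YoungDiagram where
  cells := μ.cells ∪ (finite_addable μ).toFinset.filter fun c => res n (content c) = i
  isLowerSet := by
    intro a b hba ha
    simp only [Finset.coe_union, Finset.coe_filter, Set.mem_union, Finset.mem_coe,
      Set.mem_ofPred_eq, Set.Finite.mem_toFinset] at ha ⊢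
    rcases ha with ha | ⟨ha, hc⟩
    · exact Or.inl (μ.isLowerSet hba ha)
    · rcases ha.2 hba (Set.mem_insert _ _) with h | h
      · exact Or.inr (h ▸ ⟨ha, hc⟩)
      · exact Or.inl h

open Classical in
/-- The partition `μ` without all its removable boxes of content `i` modulo `n`. -/
noncomputable def removeBoxes {n : ℕ} [NeZero n] (i : Fin n) (μ : YoungDiagram) :
    YoungDiagram where
  cells := μ.cells.filter fun c => ¬ (Removable μ c ∧ res n (content c) = i)
  isLowerSet := by
    intro a b hba ha
    simp only [Finset.coe_filter, Set.mem_ofPred_eq, YoungDiagram.mem_cells] at ha ⊢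
    refine ⟨μ.isLowerSet hba ha.1, fun hb => ha.2 ?_⟩
    by_cases hab : a = b
    · exact hab ▸ hb
    · exact absurd rfl (hb.1.2 hba ⟨ha.1, hab⟩).2

open Classical in
/-- The action of the generator `s_i` on `n`-cores (an `n`-core never has both addable and removable
boxes of content `i` modulo `n`). -/
noncomputable def sCore {n : ℕ} [NeZero n] (i : Fin n) (μ : YoungDiagram) : YoungDiagram :=
  if ∃ c, Addable μ c ∧ res n (content c) = i then addBoxes i μ
  else if ∃ c, Removable μ c ∧ res n (content c) = i then removeBoxes i μ
  else μ

/-- `ν = w μ` for the action on `n`-cores: `ν` arises from `μ` by applying the generators in some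
expression `w = s_{i_1} ⋯ s_{i_r}`, from right to left. -/
def IsActionOn {n : ℕ} [Fact (2 < n)] (w : affineSymm n) (μ ν : YoungDiagram) : Prop :=
  ∃ l : List (Fin n), (l.map s).prod = w ∧ l.foldr sCore μ = ν

theorem exists_isActionOn {n : ℕ} [Fact (2 < n)] (w : affineSymm n) (μ : YoungDiagram) :
    ∃ ν, IsActionOn w μ ν :=
  let ⟨l, hl⟩ := exists_word w
  ⟨_, l, hl, rfl⟩

/-- The hook length of the box in row `c.1` and column `c.2`: the number of boxes to its right, plus
the number of boxes below it, plus one. -/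
def hookLength (μ : YoungDiagram) (c : ℕ × ℕ) : ℕ :=
  (μ.rowLen c.1 - (c.2 + 1)) + (μ.colLen c.2 - (c.1 + 1)) + 1

/-- The positive abacus: all negative integers and the hook lengths of the first column. -/
def positiveAbacus (μ : YoungDiagram) : Set ℤ :=
  {x | x < 0} ∪ {x | ∃ r, (r, 0) ∈ μ ∧ x = hookLength μ (r, 0)}

/-- The first number on runner `i` that is not a bead. -/
noncomputable def firstGap {n : ℕ} (B : Set ℤ) (i : Fin n) : ℤ :=
  sInf {x : ℤ | x % n = ((i : ℕ) : ℤ) ∧ x ∉ B}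

/-- The row number of the first number on runner `i` that is not a bead. -/
noncomputable def gapRow {n : ℕ} (B : Set ℤ) (i : Fin n) : ℤ := firstGap B i / n

/-- The balance number of an abacus with `n` runners. -/
noncomputable def balanceNumber (n : ℕ) (B : Set ℤ) : ℤ := ∑ i : Fin n, gapRow B i

/-- The balanced `n`-abacus of `μ`: the translate of the positive abacus with balance number `0`.
See `balanceNumber_balancedAbacus`. -/
noncomputable def balancedAbacus (n : ℕ) (μ : YoungDiagram) : Set ℤ :=
  (fun x => x - balanceNumber n (positiveAbacus μ)) '' positiveAbacus μ

theorem isLeast_firstGap {n : ℕ} [NeZero n] {B : Set ℤ} {a b : ℤ} (ha : ∀ x < a, x ∈ B)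
    (hb : ∀ x, b ≤ x → x ∉ B) (i : Fin n) :
    IsLeast {x : ℤ | x % n = ((i : ℕ) : ℤ) ∧ x ∉ B} (firstGap B i) := by
  have hn : (0 : ℤ) < n := by exact_mod_cast Nat.pos_of_ne_zero (NeZero.ne n)
  have hne : {x : ℤ | x % n = ((i : ℕ) : ℤ) ∧ x ∉ B}.Nonempty := by
    refine ⟨(i : ℕ) + n * |b|, ?_, hb _ ?_⟩
    · rw [Int.add_mul_emod_self_left, Int.emod_eq_of_lt (by omega) (by exact_mod_cast i.isLt)]
    · have := le_abs_self b
      have := abs_nonneg b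
      nlinarith
  have hbd : BddBelow {x : ℤ | x % n = ((i : ℕ) : ℤ) ∧ x ∉ B} :=
    ⟨a, fun x hx => not_lt.1 fun h => hx.2 (ha x h)⟩
  exact ⟨Int.csInf_mem hne hbd, fun x hx => csInf_le hbd hx⟩

theorem balanceNumber_translate {n : ℕ} [NeZero n] {B : Set ℤ} {a b : ℤ} (ha : ∀ x < a, x ∈ B)
    (hb : ∀ x, b ≤ x → x ∉ B) (c : ℤ) :
    balanceNumber n ((fun x => x - c) '' B) = balanceNumber n B - c := by
  have hn : (n : ℤ) ≠ 0 := by exact_mod_cast NeZero.ne n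
  have hmem : ∀ x, x ∈ (fun x => x - c) '' B ↔ x + c ∈ B := fun x =>
    ⟨fun ⟨y, hy, e⟩ => by rw [← e]; simpa using hy, fun h => ⟨x + c, h, by simp⟩⟩
  have hB := isLeast_firstGap (n := n) ha hb
  have hC := isLeast_firstGap (n := n) (B := (fun x => x - c) '' B) (a := a - c) (b := b - c)
    (fun x hx => (hmem x).2 (ha _ (by omega))) (fun x hx h => hb _ (by omega) ((hmem x).1 h))
  have hrow : ∀ D : Set ℤ, (∀ i : Fin n, IsLeast {x : ℤ | x % n = ((i : ℕ) : ℤ) ∧ x ∉ D}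
      (firstGap D i)) →
      ∑ i : Fin n, firstGap D i = n * balanceNumber n D + ∑ i : Fin n, ((i : ℕ) : ℤ) := by
    intro D hD
    rw [balanceNumber, Finset.mul_sum, ← Finset.sum_add_distrib]
    refine Finset.sum_congr rfl fun i _ => ?_
    have := (hD i).1.1
    rw [← this, gapRow, Int.mul_ediv_add_emod]
  have hper : Function.Periodic (fun x => firstGap B (res n x)) (n : ℤ) := fun x => by
    have : res n (x + n) = res n x := by rw [res_eq_iff]; simp
    simp only [this]
  have hshift : ∀ i : Fin n, firstGap ((fun x => x - c) '' B) i
      = firstGap B (res n ((i : ℕ) + c)) - c := by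
    intro i
    refine (hC i).unique ?_
    obtain ⟨⟨h1, h2⟩, h3⟩ := hB (res n ((i : ℕ) + c))
    rw [res_val] at h1
    refine ⟨⟨?_, fun h => h2 (by simpa using (hmem _).1 h)⟩, ?_⟩
    · have : firstGap B (res n ((i : ℕ) + c)) - c ≡ ((i : ℕ) : ℤ) [ZMOD n] := by
        have := Int.ModEq.sub_right c (show _ ≡ _ [ZMOD n] from h1)
        simpa using this
      rw [this, Int.emod_eq_of_lt (by omega) (by exact_mod_cast i.isLt)]
    · rintro x ⟨hx1, hx2⟩
      have := h3 (show x + c ∈ _ from ⟨by rw [res_val, ← hx1]; simp, fun h => hx2 ((hmem x).2 h)⟩)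
      omega
  have e1 := hrow _ hB
  have e2 := hrow _ hC
  have e3 := sum_periodic_comp hper (Equiv.addRight c) (fun m => by simp; ring)
  simp only [Equiv.coe_addRight, res_coe] at e3
  simp only [hshift, Finset.sum_sub_distrib, e3, e1] at e2
  simp only [Finset.sum_const, Finset.card_univ, Fintype.card_fin, nsmul_eq_mul] at e2
  have e4 : (n : ℤ) * balanceNumber n ((fun x => x - c) '' B) = n * (balanceNumber n B - c) := by
    rw [mul_sub]; linarith
  exact mul_left_cancel₀ hn e4

theorem balanceNumber_balancedAbacus (n : ℕ) [NeZero n] (μ : YoungDiagram) :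
    balanceNumber n (balancedAbacus n μ) = 0 := by
  have hb : ∀ x : ℤ, ((μ.rowLen 0 + μ.colLen 0 + 2 : ℕ) : ℤ) ≤ x → x ∉ positiveAbacus μ := by
    rintro x hx (h | ⟨r, hr, h⟩)
    · simp only [Set.mem_ofPred_eq] at h; omega
    · have := μ.rowLen_anti 0 r (Nat.zero_le r)
      simp only [hookLength] at h
      omega
  rw [balancedAbacus, balanceNumber_translate (B := positiveAbacus μ) (a := 0)
    (fun x hx => Or.inl hx) hb, sub_self]

/-- The `n`-vector `(a_1, …, a_n)` of `μ`. -/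
noncomputable def nVector {n : ℕ} (μ : YoungDiagram) (i : Fin n) : ℤ :=
  gapRow (balancedAbacus n μ) i

/-- The element of the `n`-set `S(μ) = {n a_1, n a_2 + 1, …, n a_n + (n - 1)}` that is congruent to
`i` modulo `n`, for `0 ≤ i ≤ n - 1`. -/
noncomputable def nSet {n : ℕ} (μ : YoungDiagram) (i : Fin n) : ℤ :=
  n * nVector μ i + (i : ℕ)

end AffineCore

open AffineCore

namespace AffineCore

/-! ## The beta-set of a partition -/

/-! Both halves of the theorem read `w` as a bijection between positions and values on `ℤ`. Write
`X` for the window of `w⁻¹`; `X m` is the position at which `w` takes the value `m`, and `X m + n q`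
the position of `m + n q`.

Geometry, (i)–(iii). With the extension `extend u (x + n) = extend u x - 1`, all the inequalities
cutting out `A₀` become the single condition that `extend u` is antitone, and `w A₀` consists of the
`u` in `V` for which `extend u ∘ w` is antitone (`mem_alcove_iff`). The centre of `w A₀` pairs with
`ε_i - ε_j` to `(X j - X i) / n`. This lies between `k` and `k + 1`, and strictly so because window
entries are distinct modulo `n`. The facets of `w A₀` come from neighbouring positions. The equation
of `H_{α,k}` says that the values at positions `X i + n k` and `X j` agree. If these positions are
adjacent, this is one of the defining inequalities made tight, and all the others can stay strict
(`isWall_of_window_sub_eq`). If a position lies strictly between, antitonicity forces a further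
independent equation on the face, whose dimension then drops (`window_sub_eq_of_isWall`). The upper
wall is the lower wall of `-α`.

Cores, (iv). Encode a partition by its beads `λ_r - r - 1`. On the partitions reached from `∅`, the
generator `s_i` permutes the beads just as it permutes `ℤ`, so the beads of `w⁻¹ ∅` are the `x` with
`w x < 0` (`mem_betaSet_of_isActionOn`). This set is already balanced, and its first gap on runner
`i` is `w⁻¹ (w i mod n)`, the window entry at `σ i` (`nSet_eq_window`). -/

/-- The bead of row `r`. -/
def bead (μ : YoungDiagram) (r : ℕ) : ℤ := (μ.rowLen r : ℤ) - r - 1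

/-- The set of beads, one for each row, the empty rows included. -/
def betaSet (μ : YoungDiagram) : Set ℤ := Set.range (bead μ)

/-- Beads strictly decrease with the row, so the number just above a bead can only be the bead of
the preceding row. -/
theorem bead_add_one_mem_betaSet_iff (μ : YoungDiagram) (r : ℕ) :
    bead μ r + 1 ∈ betaSet μ ↔ ∃ r', r = r' + 1 ∧ μ.rowLen r' = μ.rowLen r := by
  constructor
  · rintro ⟨r', h⟩
    simp only [bead] at h
    rcases le_or_gt r r' with hr | hr
    · have := μ.rowLen_anti r r' hr
      omega
    · have := μ.rowLen_anti r' r hr.le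
      exact ⟨r', by omega, by omega⟩
  · rintro ⟨r', rfl, h⟩
    exact ⟨r', by simp only [bead, h]; push_cast; ring⟩

theorem bead_sub_one_mem_betaSet_iff (μ : YoungDiagram) (r : ℕ) :
    bead μ r - 1 ∈ betaSet μ ↔ μ.rowLen (r + 1) = μ.rowLen r := by
  constructor
  · rintro ⟨r', h⟩
    simp only [bead] at h
    rcases le_or_gt r' r with hr | hr
    · have := μ.rowLen_anti r' r hr
      omega
    · have := μ.rowLen_anti r r' hr.le
      obtain rfl : r' = r + 1 := by omega
      omega
  · intro h
    exact ⟨r + 1, by simp only [bead, h]; push_cast; ring⟩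

/-- Adding a box to row `r` moves its bead one step up; the result is a partition exactly when the
target is free. The content of the new box is the target. -/
theorem addable_iff (μ : YoungDiagram) (r c : ℕ) :
    Addable μ (r, c) ↔ c = μ.rowLen r ∧ bead μ r + 1 ∉ betaSet μ := by
  rw [bead_add_one_mem_betaSet_iff]
  constructor
  · rintro ⟨h1, h2⟩
    rw [YoungDiagram.mem_iff_lt_rowLen, not_lt] at h1
    have hc : c = μ.rowLen r := by
      rcases c with _ | c
      · omega
      · rcases h2 (show ((r, c) : ℕ × ℕ) ≤ (r, c + 1) from ⟨le_rfl, Nat.le_succ c⟩)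
          (Set.mem_insert _ _) with h | h
        · simp at h
        · have := YoungDiagram.mem_iff_lt_rowLen.1 (show (r, c) ∈ μ from h)
          omega
    refine ⟨hc, ?_⟩
    rintro ⟨r', rfl, h⟩
    rcases h2 (show ((r', c) : ℕ × ℕ) ≤ (r' + 1, c) from ⟨Nat.le_succ r', le_rfl⟩)
      (Set.mem_insert _ _) with h | h
    · simp at h
    · have := YoungDiagram.mem_iff_lt_rowLen.1 (show (r', c) ∈ μ from h)
      omega
  · rintro ⟨rfl, h⟩
    refine ⟨by rw [YoungDiagram.mem_iff_lt_rowLen]; omega, ?_⟩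
    rintro ⟨a, b⟩ ⟨a', b'⟩ hle (hm | hm)
    · obtain ⟨rfl, rfl⟩ := Prod.mk.inj hm
      obtain ⟨ha, hb⟩ := Prod.mk_le_mk.1 hle
      by_cases hab : ((a', b') : ℕ × ℕ) = (a, μ.rowLen a)
      · exact Or.inl hab
      right
      change (a', b') ∈ μ
      rw [YoungDiagram.mem_iff_lt_rowLen]
      rcases ha.eq_or_lt with rfl | ha
      · have : b' ≠ μ.rowLen a' := fun e => hab (by rw [e])
        omega
      · obtain ⟨r, rfl⟩ : ∃ r, a = r + 1 := ⟨a - 1, by omega⟩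
        have h1 : μ.rowLen r ≠ μ.rowLen (r + 1) := fun e => h ⟨r, rfl, e⟩
        have h2 := μ.rowLen_anti r (r + 1) (Nat.le_succ r)
        have h3 := μ.rowLen_anti a' r (by omega)
        omega
    · exact Or.inr (μ.isLowerSet hle hm)

theorem removable_iff (μ : YoungDiagram) (r c : ℕ) :
    Removable μ (r, c) ↔ c + 1 = μ.rowLen r ∧ bead μ r - 1 ∉ betaSet μ := by
  rw [bead_sub_one_mem_betaSet_iff]
  constructor
  · rintro ⟨h1, h2⟩
    rw [YoungDiagram.mem_iff_lt_rowLen] at h1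
    have hc : c + 1 = μ.rowLen r := by
      by_contra hne
      have hm : (r, c + 1) ∈ μ := YoungDiagram.mem_iff_lt_rowLen.2 (by omega)
      exact (h2 (show ((r, c) : ℕ × ℕ) ≤ (r, c + 1) from ⟨le_rfl, Nat.le_succ c⟩)
        ⟨hm, by simp⟩).2 rfl
    refine ⟨hc, fun h => ?_⟩
    have hm : (r + 1, c) ∈ μ := YoungDiagram.mem_iff_lt_rowLen.2 (by omega)
    exact (h2 (show ((r, c) : ℕ × ℕ) ≤ (r + 1, c) from ⟨Nat.le_succ r, le_rfl⟩)
      ⟨hm, by simp⟩).2 rfl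
  · rintro ⟨hc, h⟩
    refine ⟨by rw [YoungDiagram.mem_iff_lt_rowLen]; omega, ?_⟩
    rintro ⟨a, b⟩ ⟨a', b'⟩ hle ⟨hm, hne⟩
    refine ⟨μ.isLowerSet hle hm, fun e => hne ?_⟩
    obtain ⟨rfl, rfl⟩ := Prod.mk.inj e
    obtain ⟨ha, hb⟩ := Prod.mk_le_mk.1 hle
    have hm' := YoungDiagram.mem_iff_lt_rowLen.1 (show (a, b) ∈ μ from hm)
    rcases ha.eq_or_lt with rfl | ha
    · exact Prod.ext rfl (by simp only; omega)
    · have h2 := μ.rowLen_anti a' (a' + 1) (Nat.le_succ a')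
      have h3 := μ.rowLen_anti (a' + 1) a (by omega)
      omega

/-! ### Generators acting on beads -/

theorem rowLen_eq_of_mem_iff {μ : YoungDiagram} {r l : ℕ} (h : ∀ c, (r, c) ∈ μ ↔ c < l) :
    μ.rowLen r = l := by
  have h1 := h l
  have h2 := h (μ.rowLen r)
  rw [YoungDiagram.mem_iff_lt_rowLen] at h1 h2
  omega

theorem res_eq_iff_emod {n : ℕ} [NeZero n] (x : ℤ) (i : Fin n) :
    res n x = i ↔ x % n = ((i : ℕ) : ℤ) := by
  rw [← res_val, Fin.ext_iff, Nat.cast_inj]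

open Classical in
theorem bead_addBoxes {n : ℕ} [NeZero n] (i : Fin n) (μ : YoungDiagram) (r : ℕ) :
    bead (addBoxes i μ) r = bead μ r
      + if (bead μ r + 1) % n = ((i : ℕ) : ℤ) ∧ bead μ r + 1 ∉ betaSet μ then 1 else 0 := by
  have hmem : ∀ c, (r, c) ∈ addBoxes i μ ↔
      c < μ.rowLen r ∨ (Addable μ (r, c) ∧ res n (content (r, c)) = i) := fun c => by
    rw [← YoungDiagram.mem_iff_lt_rowLen, ← YoungDiagram.mem_cells]
    simp [addBoxes]
  have hrow : (addBoxes i μ).rowLen r = μ.rowLen r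
      + if (bead μ r + 1) % n = ((i : ℕ) : ℤ) ∧ bead μ r + 1 ∉ betaSet μ then 1 else 0 := by
    refine rowLen_eq_of_mem_iff fun c => ?_
    rw [hmem, addable_iff, res_eq_iff_emod]
    have e : c = μ.rowLen r → content (r, c) = bead μ r + 1 := by
      rintro rfl
      simp [content, bead]
    split_ifs with h
    · constructor
      · rintro (h1 | ⟨⟨rfl, _⟩, _⟩) <;> omega
      · intro hc
        rcases (Nat.lt_succ_iff.1 hc).lt_or_eq with hc | hc
        · exact Or.inl hc
        · exact Or.inr ⟨⟨hc, h.2⟩, by rw [e hc]; exact h.1⟩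
    · constructor
      · rintro (h1 | ⟨⟨hc, h2⟩, h3⟩)
        · omega
        · rw [e hc] at h3
          exact absurd ⟨h3, h2⟩ h
      · exact fun hc => Or.inl hc
  rw [bead, hrow]
  by_cases h : (bead μ r + 1) % n = ((i : ℕ) : ℤ) ∧ bead μ r + 1 ∉ betaSet μ
  · simp only [if_pos h]
    rw [bead]
    push_cast
    ring
  · simp only [if_neg h]
    rw [bead]
    push_cast
    ring

open Classical in
theorem bead_removeBoxes {n : ℕ} [NeZero n] (i : Fin n) (μ : YoungDiagram) (r : ℕ) :
    bead (removeBoxes i μ) r = bead μ r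
      - if bead μ r % n = ((i : ℕ) : ℤ) ∧ bead μ r - 1 ∉ betaSet μ then 1 else 0 := by
  have hmem : ∀ c, (r, c) ∈ removeBoxes i μ ↔
      c < μ.rowLen r ∧ ¬ (Removable μ (r, c) ∧ res n (content (r, c)) = i) := fun c => by
    rw [← YoungDiagram.mem_iff_lt_rowLen, ← YoungDiagram.mem_cells]
    simp [removeBoxes]
  -- Row lengths are natural numbers, so the subtraction of one must be shown not to truncate.
  have hpos : bead μ r - 1 ∉ betaSet μ → 0 < μ.rowLen r := fun h => by
    rw [bead_sub_one_mem_betaSet_iff] at h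
    have := μ.rowLen_anti r (r + 1) (Nat.le_succ r)
    omega
  have hrow : (removeBoxes i μ).rowLen r = μ.rowLen r
      - if bead μ r % n = ((i : ℕ) : ℤ) ∧ bead μ r - 1 ∉ betaSet μ then 1 else 0 := by
    refine rowLen_eq_of_mem_iff fun c => ?_
    rw [hmem, removable_iff, res_eq_iff_emod]
    have e : c + 1 = μ.rowLen r → content (r, c) = bead μ r := fun hc => by
      simp only [content, bead, ← hc]
      push_cast
      ring
    split_ifs with h
    · constructor
      · rintro ⟨h1, h2⟩
        by_contra hc
        have hc : c + 1 = μ.rowLen r := by omega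
        exact h2 ⟨⟨hc, h.2⟩, by rw [e hc]; exact h.1⟩
      · intro hc
        exact ⟨by omega, fun h => by omega⟩
    · refine ⟨fun hc => hc.1, fun hc => ⟨hc, ?_⟩⟩
      rintro ⟨⟨hc, h2⟩, h3⟩
      rw [e hc] at h3
      exact h ⟨h3, h2⟩
  rw [bead, hrow]
  by_cases h : bead μ r % n = ((i : ℕ) : ℤ) ∧ bead μ r - 1 ∉ betaSet μ
  · have := hpos h.2
    simp only [if_pos h]
    rw [bead]
    omega
  · simp only [if_neg h]
    rw [bead]
    omega

/-- The hypothesis `h` excludes removable boxes of residue `i`. Each pair `c - 1, c` with `c ≡ i` is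
then full, empty, or has its only bead at `c - 1`; moving that bead up is the same as swapping the
pair. -/
theorem betaSet_addBoxes {n : ℕ} [Fact (2 < n)] (i : Fin n) (μ : YoungDiagram)
    (h : ∀ c : ℤ, c % n = ((i : ℕ) : ℤ) → c ∈ betaSet μ → c - 1 ∈ betaSet μ) (x : ℤ) :
    x ∈ betaSet (addBoxes i μ) ↔ sMap n i x ∈ betaSet μ := by
  constructor
  · rintro ⟨r, rfl⟩
    have hr : bead μ r ∈ betaSet μ := ⟨r, rfl⟩
    have k1 := emod_add_one_ne (n := n) (bead μ r)
    rw [bead_addBoxes]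
    unfold sMap
    split_ifs with h1 h2 h3 h4 h5 <;> simp_all
  · intro hx
    have key : ∀ y ∈ betaSet μ, ¬ ((y + 1) % n = ((i : ℕ) : ℤ) ∧ y + 1 ∉ betaSet μ) →
        y ∈ betaSet (addBoxes i μ) := by
      rintro _ ⟨r, rfl⟩ hy
      exact ⟨r, by rw [bead_addBoxes, if_neg hy, add_zero]⟩
    have k1 := emod_add_one_ne (n := n) x
    unfold sMap at hx
    split_ifs at hx with h1 h2
    · by_cases hm : x ∈ betaSet μ
      · exact key x hm fun hc => k1 (hc.1.trans h1.symm)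
      · obtain ⟨r, hr⟩ := hx
        have e : bead μ r + 1 = x := by rw [hr]; ring
        exact ⟨r, by rw [bead_addBoxes, e, if_pos ⟨h1, hm⟩, e]⟩
    · have := h _ h2 hx
      rw [add_sub_cancel_right] at this
      exact key x this fun hc => hc.2 hx
    · exact key x hx fun hc => h2 hc.1

theorem betaSet_removeBoxes {n : ℕ} [Fact (2 < n)] (i : Fin n) (μ : YoungDiagram)
    (h : ∀ c : ℤ, c % n = ((i : ℕ) : ℤ) → c - 1 ∈ betaSet μ → c ∈ betaSet μ) (x : ℤ) :
    x ∈ betaSet (removeBoxes i μ) ↔ sMap n i x ∈ betaSet μ := by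
  constructor
  · rintro ⟨r, rfl⟩
    have hr : bead μ r ∈ betaSet μ := ⟨r, rfl⟩
    have k1 := emod_add_one_ne (n := n) (bead μ r)
    have k2 := emod_add_one_ne (n := n) (bead μ r - 1)
    have h' := h (bead μ r + 1)
    rw [sub_add_cancel] at k2
    rw [bead_removeBoxes]
    unfold sMap
    split_ifs <;> simp_all
  · intro hx
    have key : ∀ y ∈ betaSet μ, ¬ (y % n = ((i : ℕ) : ℤ) ∧ y - 1 ∉ betaSet μ) →
        y ∈ betaSet (removeBoxes i μ) := by
      rintro _ ⟨r, rfl⟩ hy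
      exact ⟨r, by rw [bead_removeBoxes, if_neg hy, sub_zero]⟩
    have k1 := emod_add_one_ne (n := n) x
    unfold sMap at hx
    split_ifs at hx with h1 h2
    · exact key x (h _ h1 hx) fun hc => hc.2 hx
    · by_cases hm : x ∈ betaSet μ
      · exact key x hm fun hc => h1 hc.1
      · obtain ⟨r, hr⟩ := hx
        refine ⟨r, ?_⟩
        rw [bead_removeBoxes, hr, add_sub_cancel_right, if_pos ⟨h2, hm⟩, add_sub_cancel_right]
    · exact key x hx fun hc => h1 hc.1

theorem exists_addable_iff {n : ℕ} [NeZero n] (i : Fin n) (μ : YoungDiagram) :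
    (∃ c, Addable μ c ∧ res n (content c) = i) ↔
      ∃ c : ℤ, c % n = ((i : ℕ) : ℤ) ∧ c - 1 ∈ betaSet μ ∧ c ∉ betaSet μ := by
  constructor
  · rintro ⟨⟨r, c⟩, h1, h2⟩
    obtain ⟨rfl, h3⟩ := (addable_iff μ r c).1 h1
    rw [res_eq_iff_emod] at h2
    have e : content (r, μ.rowLen r) = bead μ r + 1 := by simp [content, bead]
    exact ⟨bead μ r + 1, e ▸ h2, ⟨r, by ring⟩, h3⟩
  · rintro ⟨c, h1, ⟨r, hr⟩, h3⟩
    obtain rfl : c = bead μ r + 1 := by omega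
    refine ⟨(r, μ.rowLen r), (addable_iff _ _ _).2 ⟨rfl, h3⟩, ?_⟩
    rw [res_eq_iff_emod, ← h1]
    simp [content, bead]

theorem exists_removable_iff {n : ℕ} [NeZero n] (i : Fin n) (μ : YoungDiagram) :
    (∃ c, Removable μ c ∧ res n (content c) = i) ↔
      ∃ c : ℤ, c % n = ((i : ℕ) : ℤ) ∧ c ∈ betaSet μ ∧ c - 1 ∉ betaSet μ := by
  constructor
  · rintro ⟨⟨r, c⟩, h1, h2⟩
    obtain ⟨hc, h1⟩ := (removable_iff μ r c).1 h1
    rw [res_eq_iff_emod] at h2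
    have e : content (r, c) = bead μ r := by
      simp only [content, bead, ← hc]; push_cast; ring
    exact ⟨bead μ r, e ▸ h2, ⟨r, rfl⟩, h1⟩
  · rintro ⟨_, h1, ⟨r, rfl⟩, h3⟩
    have hpos : 0 < μ.rowLen r := by
      have h := h3
      rw [bead_sub_one_mem_betaSet_iff] at h
      have := μ.rowLen_anti r (r + 1) (Nat.le_succ r)
      omega
    refine ⟨(r, μ.rowLen r - 1), (removable_iff _ _ _).2 ⟨by omega, h3⟩, ?_⟩
    have e : content (r, μ.rowLen r - 1) = bead μ r := by
      simp only [content, bead]; omega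
    rw [res_eq_iff_emod, e, h1]

/-- If the beads of `μ` are the numbers that `u` makes negative, then those of `s_i μ` are the
numbers that `u s_i` makes negative. -/
theorem mem_betaSet_sCore {n : ℕ} [Fact (2 < n)] (u : affineSymm n) (i : Fin n)
    (μ : YoungDiagram) (hμ : ∀ x, x ∈ betaSet μ ↔ u.1 x < 0) (x : ℤ) :
    x ∈ betaSet (sCore i μ) ↔ u.1 (sMap n i x) < 0 := by
  -- By periodicity the order of `u (c - 1)` and `u c` is the same for every `c ≡ i`. Hence addable
  -- and removable boxes of residue `i` cannot coexist.
  have hshift : ∀ c c' : ℤ, c % n = ((i : ℕ) : ℤ) → c' % n = ((i : ℕ) : ℤ) →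
      ∃ q : ℤ, u.1 c' = u.1 c + n * q ∧ u.1 (c' - 1) = u.1 (c - 1) + n * q := by
    intro c c' hc hc'
    obtain ⟨q, hq⟩ := Int.ModEq.dvd (show c ≡ c' [ZMOD n] from hc.trans hc'.symm)
    refine ⟨q, ?_, ?_⟩
    · rw [← apply_add_mul u.2.1]; congr 1; omega
    · rw [← apply_add_mul u.2.1]; congr 1; omega
  rw [← hμ]
  unfold sCore
  rw [exists_addable_iff, exists_removable_iff]
  split_ifs with h1 h2
  · obtain ⟨c, hc, h3, h4⟩ := h1
    refine betaSet_addBoxes i μ (fun c' hc' h5 => ?_) x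
    obtain ⟨q, e1, e2⟩ := hshift c c' hc hc'
    rw [hμ] at h3 h4 h5 ⊢
    omega
  · obtain ⟨c, hc, h3, h4⟩ := h2
    refine betaSet_removeBoxes i μ (fun c' hc' h5 => ?_) x
    obtain ⟨q, e1, e2⟩ := hshift c c' hc hc'
    rw [hμ] at h3 h4 h5 ⊢
    omega
  -- Every pair `x - 1, x` with `x ≡ i` is full or empty, so swapping it changes nothing.
  · push Not at h1 h2
    have a1 := h1 x
    have a2 := h2 x
    have a3 := h1 (x + 1)
    have a4 := h2 (x + 1)
    rw [add_sub_cancel_right] at a3 a4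
    unfold sMap
    split_ifs with c1 c2
    · exact ⟨a2 c1, a1 c1⟩
    · exact ⟨a3 c2, a4 c2⟩
    · rfl

theorem mem_betaSet_bot (x : ℤ) : x ∈ betaSet ⊥ ↔ x < 0 := by
  have h0 : ∀ r, (⊥ : YoungDiagram).rowLen r = 0 := fun r =>
    rowLen_eq_of_mem_iff fun c => by simp
  constructor
  · rintro ⟨r, rfl⟩
    simp only [bead, h0]
    omega
  · intro hx
    exact ⟨(-x - 1).toNat, by simp only [bead, h0]; omega⟩

/-- Induction along the word. The conclusion depends only on `w`, whichever word witnesses the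
action. -/
theorem mem_betaSet_of_isActionOn {n : ℕ} [Fact (2 < n)] {w : affineSymm n} {μ : YoungDiagram}
    (h : IsActionOn w ⊥ μ) (x : ℤ) : x ∈ betaSet μ ↔ (w⁻¹).1 x < 0 := by
  obtain ⟨l, rfl, rfl⟩ := h
  induction l generalizing x with
  | nil => simpa using mem_betaSet_bot x
  | cons i l ih =>
    have hi : (s i)⁻¹ = s i := by
      rw [inv_eq_iff_mul_eq_one]
      ext y
      exact sMap_sMap i y
    rw [List.foldr_cons, mem_betaSet_sCore _ i _ ih]
    simp only [List.map_cons, List.prod_cons, mul_inv_rev, hi]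
    rfl

/-! ### The balanced abacus and the `n`-set -/

/-- With `ℓ` nonempty rows, the first hook of such a row `r` has length `λ_r - r - 1 + ℓ`; the empty
rows supply the negative integers. -/
theorem positiveAbacus_eq (μ : YoungDiagram) :
    positiveAbacus μ = (fun x => x + (μ.colLen 0 : ℤ)) '' betaSet μ := by
  have hmem : ∀ r, (r, 0) ∈ μ → 0 < μ.rowLen r ∧ r < μ.colLen 0 := fun r hr =>
    ⟨YoungDiagram.mem_iff_lt_rowLen.1 hr, YoungDiagram.mem_iff_lt_colLen.1 hr⟩
  ext x
  constructor
  · rintro (h | ⟨r, hr, rfl⟩)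
    · have hx : x < 0 := h
      have hr : μ.rowLen (μ.colLen 0 + (-x - 1).toNat) = 0 := by
        by_contra hne
        have h1 : ((μ.colLen 0 + (-x - 1).toNat, 0) : ℕ × ℕ) ∈ μ :=
          YoungDiagram.mem_iff_lt_rowLen.2 (Nat.pos_of_ne_zero hne)
        have := YoungDiagram.mem_iff_lt_colLen.1 h1
        omega
      refine ⟨_, ⟨μ.colLen 0 + (-x - 1).toNat, rfl⟩, ?_⟩
      simp only [bead, hr]
      omega
    · have := hmem r hr
      refine ⟨_, ⟨r, rfl⟩, ?_⟩
      simp only [bead, hookLength]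
      omega
  · rintro ⟨_, ⟨r, rfl⟩, rfl⟩
    by_cases hr : (r, 0) ∈ μ
    · have := hmem r hr
      refine Or.inr ⟨r, hr, ?_⟩
      simp only [bead, hookLength]
      omega
    · left
      have h1 : μ.rowLen r = 0 := by
        rw [YoungDiagram.mem_iff_lt_rowLen] at hr; omega
      rw [YoungDiagram.mem_iff_lt_colLen] at hr
      simp only [Set.mem_ofPred_eq, bead, h1]
      omega

/-- On runner `i`, the number `i + n q` is a gap when `w i + n q ≥ 0`, and the least such `q` is
`-⌊w i / n⌋`. -/
theorem firstGap_of_mem_iff {n : ℕ} [NeZero n] {B : Set ℤ} (w : affineSymm n)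
    (hB : ∀ x, x ∈ B ↔ w.1 x < 0) (i : Fin n) :
    firstGap B i = ((i : ℕ) : ℤ) + n * -(w.1 ((i : ℕ) : ℤ) / n) := by
  have hn : (0 : ℤ) < n := by exact_mod_cast Nat.pos_of_ne_zero (NeZero.ne n)
  have hi : ((i : ℕ) : ℤ) % n = (i : ℕ) :=
    Int.emod_eq_of_lt (by omega) (by exact_mod_cast i.isLt)
  have hnot : ∀ q : ℤ, ((i : ℕ) : ℤ) + n * q ∉ B ↔ -(w.1 ((i : ℕ) : ℤ) / n) ≤ q := fun q => by
    rw [hB, apply_add_mul w.2.1, not_lt, neg_le, Int.le_ediv_iff_mul_le hn]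
    constructor <;> intro h <;> linarith
  refine IsLeast.csInf_eq ⟨⟨?_, (hnot _).2 le_rfl⟩, ?_⟩
  · rw [Int.add_mul_emod_self_left, hi]
  · rintro x ⟨hx1, hx2⟩
    have e : x = ((i : ℕ) : ℤ) + n * (x / n) := by rw [← hx1, Int.emod_add_mul_ediv]
    rw [e] at hx2 ⊢
    have := mul_le_mul_of_nonneg_left ((hnot _).1 hx2) hn.le
    linarith

theorem gapRow_of_mem_iff {n : ℕ} [NeZero n] {B : Set ℤ} (w : affineSymm n)
    (hB : ∀ x, x ∈ B ↔ w.1 x < 0) (i : Fin n) :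
    gapRow B i = -(w.1 ((i : ℕ) : ℤ) / n) := by
  have hn : (n : ℤ) ≠ 0 := by exact_mod_cast NeZero.ne n
  rw [gapRow, firstGap_of_mem_iff w hB, Int.add_mul_ediv_left _ _ hn,
    Int.ediv_eq_zero_of_lt (by omega) (by exact_mod_cast i.isLt), zero_add]

/-- The values `w i` have the same sum as the `i`, and their residues permute `0, …, n - 1`; so the
quotients `⌊w i / n⌋` sum to zero. -/
theorem balanceNumber_of_mem_iff {n : ℕ} [NeZero n] {B : Set ℤ} (w : affineSymm n)
    (hB : ∀ x, x ∈ B ↔ w.1 x < 0) : balanceNumber n B = 0 := by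
  have hn : (n : ℤ) ≠ 0 := by exact_mod_cast NeZero.ne n
  have hp : Function.Periodic (fun x : ℤ => x % n) (n : ℤ) := fun x => Int.add_emod_right x n
  have h1 := sum_periodic_comp hp w.1 w.2.1
  have h2 : ∑ i : Fin n, ((i : ℕ) : ℤ) % n = ∑ i : Fin n, ((i : ℕ) : ℤ) :=
    Finset.sum_congr rfl fun i _ => Int.emod_eq_of_lt (by omega) (by exact_mod_cast i.isLt)
  have h3 : ∑ i : Fin n, w.1 ((i : ℕ) : ℤ)
      = n * ∑ i : Fin n, w.1 ((i : ℕ) : ℤ) / n + ∑ i : Fin n, w.1 ((i : ℕ) : ℤ) % n := by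
    rw [Finset.mul_sum, ← Finset.sum_add_distrib]
    exact Finset.sum_congr rfl fun i _ => (Int.mul_ediv_add_emod _ _).symm
  have h4 : (n : ℤ) * ∑ i : Fin n, w.1 ((i : ℕ) : ℤ) / n = 0 := by
    have := w.2.2
    linarith
  simp only [balanceNumber, gapRow_of_mem_iff w hB, Finset.sum_neg_distrib]
  rw [(mul_eq_zero.1 h4).resolve_left hn, neg_zero]

theorem balancedAbacus_eq_betaSet {n : ℕ} [NeZero n] (w : affineSymm n) {μ : YoungDiagram}
    (hμ : ∀ x, x ∈ betaSet μ ↔ w.1 x < 0) : balancedAbacus n μ = betaSet μ := by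
  have ha : ∀ x < -(μ.colLen 0 : ℤ), x ∈ betaSet μ := fun x hx => by
    have h : x + μ.colLen 0 ∈ positiveAbacus μ :=
      Or.inl (show x + (μ.colLen 0 : ℤ) < 0 by omega)
    rw [positiveAbacus_eq] at h
    obtain ⟨y, hy, e⟩ := h
    obtain rfl : y = x := by simpa using e
    exact hy
  have hb : ∀ x : ℤ, (μ.rowLen 0 : ℤ) ≤ x → x ∉ betaSet μ := by
    rintro _ hx ⟨r, rfl⟩
    have := μ.rowLen_anti 0 r (Nat.zero_le r)
    simp only [bead] at hx
    omega
  have hbal := balanceNumber_translate (n := n) ha hb (-(μ.colLen 0 : ℤ))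
  rw [balanceNumber_of_mem_iff w hμ] at hbal
  simp only [sub_neg_eq_add, ← positiveAbacus_eq, zero_add] at hbal
  rw [balancedAbacus, hbal, positiveAbacus_eq, Set.image_image]
  simp

/-- Applying `w⁻¹` to `w i mod n = w i - n ⌊w i / n⌋` gives `i - n ⌊w i / n⌋`, the first gap on
runner `i`. -/
theorem nSet_eq_window {n : ℕ} [Fact (2 < n)] (w : affineSymm n) {μ : YoungDiagram}
    (hμ : IsActionOn w⁻¹ ⊥ μ) (i : Fin n) : nSet μ i = window w⁻¹ (finPart w i) := by
  have hβ : ∀ x, x ∈ betaSet μ ↔ w.1 x < 0 := fun x => by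
    rw [mem_betaSet_of_isActionOn hμ, inv_inv]
  have h1 := apply_emod (symm_apply_add w.2.1) (w.1 ((i : ℕ) : ℤ))
  rw [Equiv.symm_apply_apply] at h1
  have h2 : window w⁻¹ (finPart w i) = w.1.symm (w.1 ((i : ℕ) : ℤ) % n) := by
    rw [window, finPart_apply, res_val]; rfl
  rw [nSet, nVector, balancedAbacus_eq_betaSet w hβ, gapRow_of_mem_iff w hβ, h2]
  linarith

end AffineCore

namespace AffineCore

/-! ## Alcoves and their walls -/

theorem inner_root {n : ℕ} (v : EuclideanSpace ℝ (Fin n)) (i j : Fin n) :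
    inner ℝ v (root i j) = v i - v j := by
  simp [root, inner_sub_right, EuclideanSpace.inner_single_right]

theorem extend_add_natCast {n : ℕ} [NeZero n] (v : EuclideanSpace ℝ (Fin n)) (x : ℤ) :
    extend v (x + n) = extend v x - 1 := by
  simpa using extend_add_mul v x 1

theorem extend_lineMap {n : ℕ} [NeZero n] (u v : EuclideanSpace ℝ (Fin n)) (t : ℝ) (x : ℤ) :
    extend (AffineMap.lineMap u v t) x = AffineMap.lineMap (extend u x) (extend v x) t := by
  simp only [extend, AffineMap.lineMap_apply_module, PiLp.add_apply, PiLp.smul_apply, smul_eq_mul]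
  ring

theorem root_apply {n : ℕ} (i j m : Fin n) :
    root i j m = (if m = i then 1 else 0) - (if m = j then 1 else 0) := by
  simp [root]

theorem root_mem_V {n : ℕ} (i j : Fin n) : root i j ∈ V n := by
  change ∑ m, root i j m = 0
  simp [root_apply]

/-- The simple roots compare neighbours inside one period, and the highest root compares the last
entry with the first entry of the next period. -/
theorem mem_fundamentalAlcove_iff {n : ℕ} [Fact (2 < n)] (v : EuclideanSpace ℝ (Fin n)) :
    v ∈ fundamentalAlcove n ↔ v ∈ V n ∧ Antitone (extend v) := by
  have hn : 2 < n := Fact.out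
  have h0 : (res n 0 : ℕ) = 0 := by
    have := res_val n 0
    rw [Int.zero_emod] at this
    exact_mod_cast this
  have hlast : (((res n (-1) : Fin n) : ℕ) : ℤ) = n - 1 := by
    rw [res_val, ← Int.add_emod_right, Int.emod_eq_of_lt (by omega) (by omega)]
    ring
  have hwrap : extend v (((res n (-1) : Fin n) : ℕ) + 1) = v (res n 0) - 1 := by
    have e : (((res n (-1) : Fin n) : ℕ) : ℤ) + 1 = ((res n 0 : Fin n) : ℕ) + n := by omega
    rw [e, extend_add_natCast, extend_coe]
  constructor
  · rintro ⟨⟨hV, h1⟩, _, h2⟩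
    refine ⟨hV, antitone_int_of_succ_le fun x => ?_⟩
    have hp : Function.Periodic (fun x => extend v (x + 1) - extend v x) (n : ℤ) := fun x => by
      simp only [add_right_comm x (n : ℤ) 1, extend_add_natCast]
      ring
    rw [← sub_nonpos]
    refine (periodic_res hp x).symm.trans_le ?_
    set y := res n x
    simp only [extend_coe]
    by_cases hy : (y : ℕ) + 1 < n
    · have h3 := (h1 y ⟨y + 1, hy⟩ rfl).2
      rw [inner_root] at h3
      have e : (((y : ℕ) : ℤ) + 1) = ((⟨y + 1, hy⟩ : Fin n) : ℕ) := by push_cast; rfl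
      rw [e, extend_coe]
      push_cast at h3
      linarith
    -- The step across the end of the period is the inequality `v_1 - v_n ≤ 1`.
    · have e : y = res n (-1) := Fin.ext (by have := y.isLt; omega)
      rw [e, hwrap]
      rw [inner_root] at h2
      push_cast at h2
      linarith
  · rintro ⟨hV, h⟩
    refine ⟨⟨hV, fun i j hij => ⟨hV, ?_⟩⟩, hV, ?_⟩
    · have := h (show ((i : ℕ) : ℤ) ≤ ((j : ℕ) : ℤ) by omega)
      rw [extend_coe, extend_coe] at this
      rw [inner_root]
      push_cast
      linarith
    · have := h (show (((res n (-1) : Fin n) : ℕ) : ℤ) ≤ ((res n (-1) : Fin n) : ℕ) + 1 by omega)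
      rw [hwrap, extend_coe] at this
      rw [inner_root]
      push_cast
      linarith

theorem mem_alcove_iff {n : ℕ} [Fact (2 < n)] (w : affineSymm n) (u : EuclideanSpace ℝ (Fin n)) :
    u ∈ alcove w ↔ u ∈ V n ∧ Antitone fun x => extend u (w.1 x) := by
  constructor
  · rintro ⟨v, hv, rfl⟩
    obtain ⟨hV, h⟩ := (mem_fundamentalAlcove_iff v).1 hv
    refine ⟨act_mem_V w v hV, ?_⟩
    simpa only [extend_act, Equiv.symm_apply_apply] using h
  · rintro ⟨hV, h⟩
    refine ⟨act w⁻¹ u, (mem_fundamentalAlcove_iff _).2 ⟨act_mem_V _ _ hV, ?_⟩, ?_⟩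
    · have e : extend (act w⁻¹ u) = fun x => extend u (w.1 x) := by
        ext x
        rw [extend_act]
        rfl
      rw [e]
      exact h
    · rw [← act_mul, mul_inv_cancel, act_one]

/-! ### Centres and the bounds on window differences -/

/-- The centre of the alcove `w A₀`. -/
noncomputable def centre {n : ℕ} [NeZero n] (w : affineSymm n) : EuclideanSpace ℝ (Fin n) :=
  WithLp.toLp 2 fun m => (((n : ℝ) - 1) / 2 - window w⁻¹ m) / n

theorem centre_apply {n : ℕ} [NeZero n] (w : affineSymm n) (m : Fin n) :
    centre w m = (((n : ℝ) - 1) / 2 - window w⁻¹ m) / n := rfl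

theorem sum_coe_fin (n : ℕ) : ∑ i : Fin n, ((i : ℕ) : ℝ) = n * (((n : ℝ) - 1) / 2) := by
  rw [Fin.sum_univ_eq_sum_range (fun i => (i : ℝ))]
  induction n with
  | zero => simp
  | succ n ih =>
    rw [Finset.sum_range_succ, ih]
    push_cast
    ring

theorem centre_mem_V {n : ℕ} [NeZero n] (w : affineSymm n) : centre w ∈ V n := by
  have h1 : ∑ m : Fin n, window w⁻¹ m = ∑ i : Fin n, ((i : ℕ) : ℤ) := (w⁻¹).2.2
  have h2 : ∑ m : Fin n, (window w⁻¹ m : ℝ) = ∑ i : Fin n, ((i : ℕ) : ℝ) := by exact_mod_cast h1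
  change ∑ m, centre w m = 0
  simp only [centre_apply, ← Finset.sum_div, Finset.sum_sub_distrib, h2, sum_coe_fin,
    Finset.sum_const, Finset.card_univ, Fintype.card_fin, nsmul_eq_mul]
  ring

/-- Composed with `w`, the extended centre is an arithmetic progression of step `-1 / n`: all the
alcove inequalities hold with the same slack. -/
theorem extend_centre {n : ℕ} [NeZero n] (w : affineSymm n) (x : ℤ) :
    extend (centre w) x = (((n : ℝ) - 1) / 2 - w.1.symm x) / n := by
  have hn : (n : ℝ) ≠ 0 := by exact_mod_cast NeZero.ne n
  have h := apply_emod (symm_apply_add w.2.1) x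
  have h1 : window w⁻¹ (res n x) = w.1.symm (x % n) := by rw [window, res_val]; rfl
  rw [extend, centre_apply, h1, h]
  push_cast
  field_simp
  ring

theorem centre_mem_alcove {n : ℕ} [Fact (2 < n)] (w : affineSymm n) : centre w ∈ alcove w := by
  rw [mem_alcove_iff]
  refine ⟨centre_mem_V w, fun x y hxy => ?_⟩
  simp only [extend_centre, Equiv.symm_apply_apply]
  have : (x : ℝ) ≤ y := by exact_mod_cast hxy
  gcongr

theorem inner_centre_root {n : ℕ} [NeZero n] (w : affineSymm n) (i j : Fin n) :
    inner ℝ (centre w) (root i j) = ((window w⁻¹ j - window w⁻¹ i : ℤ) : ℝ) / n := by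
  rw [inner_root, centre_apply, centre_apply]
  push_cast
  ring

theorem window_emod_injective {n : ℕ} [NeZero n] (w : affineSymm n) {i j : Fin n}
    (h : window w i % n = window w j % n) : i = j := by
  have : finPart w i = finPart w j := by
    rw [finPart_apply, finPart_apply, res_eq_iff]
    exact h
  exact (finPart w).injective this

theorem not_dvd_window_sub {n : ℕ} [NeZero n] (w : affineSymm n) {i j : Fin n} (hij : i ≠ j)
    (k : ℤ) : window w j - window w i ≠ n * k := fun h =>
  hij (window_emod_injective w (Int.emod_eq_emod_iff_emod_sub_eq_zero.2
    (Int.emod_eq_zero_of_dvd ⟨-k, by linarith⟩)))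

theorem window_sub_bounds {n : ℕ} [Fact (2 < n)] (w : affineSymm n) {i j : Fin n} (hij : i ≠ j)
    {k : ℤ} (hk : alcove w ⊆ halfPos (root i j) k ∩ halfNeg (root i j) (k + 1)) :
    n * k < window w⁻¹ j - window w⁻¹ i ∧ window w⁻¹ j - window w⁻¹ i < n * (k + 1) := by
  have hn : (0 : ℝ) < n := by
    have : 2 < n := Fact.out
    exact_mod_cast (by omega : 0 < n)
  obtain ⟨⟨_, h1⟩, _, h2⟩ := hk (centre_mem_alcove w)
  rw [inner_centre_root] at h1 h2
  rw [le_div_iff₀ hn] at h1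
  rw [div_le_iff₀ hn] at h2
  have h1' : k * (n : ℤ) ≤ window w⁻¹ j - window w⁻¹ i := by exact_mod_cast h1
  have h2' : window w⁻¹ j - window w⁻¹ i ≤ (k + 1) * (n : ℤ) := by exact_mod_cast h2
  rw [mul_comm] at h1' h2'
  exact ⟨lt_of_le_of_ne h1' (not_dvd_window_sub _ hij k).symm,
    lt_of_le_of_ne h2' (not_dvd_window_sub _ hij (k + 1))⟩

/-! ### Walls and adjacent positions -/

theorem mem_hyperplane_root_iff {n : ℕ} (i j : Fin n) (k : ℤ) (v : EuclideanSpace ℝ (Fin n)) :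
    v ∈ hyperplane (root i j) k ↔ v ∈ V n ∧ v i - v j = k := by
  rw [← inner_root]; rfl

theorem affineSpan_subset_hyperplane {n : ℕ} (α : EuclideanSpace ℝ (Fin n)) (k : ℤ)
    {A : Set (EuclideanSpace ℝ (Fin n))} (hA : A ⊆ hyperplane α k) :
    (affineSpan ℝ A : Set (EuclideanSpace ℝ (Fin n))) ⊆ hyperplane α k := by
  intro v hv
  refine affineSpan_induction hv hA fun c x y z hx hy hz => ⟨?_, ?_⟩
  · rw [vsub_eq_sub, vadd_eq_add]
    exact (V n).add_mem ((V n).smul_mem c ((V n).sub_mem hx.1 hy.1)) hz.1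
  · rw [vsub_eq_sub, vadd_eq_add, inner_add_left, inner_smul_left, inner_sub_left, hx.2, hy.2, hz.2]
    simp

/-- Reduces the upper wall of a strip to the lower one. -/
theorem isWall_root_swap {n : ℕ} (A : Set (EuclideanSpace ℝ (Fin n))) (i j : Fin n) (k : ℤ) :
    IsWall A (root i j) k ↔ IsWall A (root j i) (-k) := by
  have h1 : halfPos (root i j) k = halfNeg (root j i) (-k) := by
    ext v
    simp only [halfPos, halfNeg, inner_root, Set.mem_ofPred_eq]
    push_cast
    constructor <;> rintro ⟨h, h'⟩ <;> exact ⟨h, by linarith⟩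
  have h2 : halfNeg (root i j) k = halfPos (root j i) (-k) := by
    ext v
    simp only [halfPos, halfNeg, inner_root, Set.mem_ofPred_eq]
    push_cast
    constructor <;> rintro ⟨h, h'⟩ <;> exact ⟨h, by linarith⟩
  have h3 : hyperplane (root i j) k = hyperplane (root j i) (-k) := by
    ext v
    simp only [mem_hyperplane_root_iff]
    push_cast
    constructor <;> rintro ⟨h, h'⟩ <;> exact ⟨h, by linarith⟩
  rw [IsWall, IsWall, h1, h2, h3, or_comm]

theorem res_apply_eq_iff {n : ℕ} [NeZero n] (w : affineSymm n) (x : ℤ) (m : Fin n) :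
    res n (w.1 x) = m ↔ ∃ q : ℤ, x = window w⁻¹ m + n * q := by
  have hw : w.1 (window w⁻¹ m) = (m : ℕ) := w.1.apply_symm_apply _
  constructor
  · intro h
    refine ⟨w.1 x / n, w.1.injective ?_⟩
    rw [apply_add_mul w.2.1, hw, ← h, res_val, Int.emod_add_mul_ediv]
  · rintro ⟨q, rfl⟩
    rw [apply_add_mul w.2.1, hw]
    conv_rhs => rw [← res_coe n m]
    rw [res_eq_iff, Int.add_mul_emod_self_left]

theorem extend_apply_window {n : ℕ} [NeZero n] (w : affineSymm n) (v : EuclideanSpace ℝ (Fin n))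
    (m : Fin n) (q : ℤ) : extend v (w.1 (window w⁻¹ m + n * q)) = v m - q := by
  rw [apply_add_mul w.2.1, extend_add_mul, ← extend_coe v m]
  congr 2
  exact w.1.apply_symm_apply _

/-- Positions `X i + n k` and `X j` are adjacent, so `u_i - k ≥ u_j` is a defining inequality. To
see that the face spans the hyperplane, start at a point `p` of the face where all other
inequalities are strict and move slightly towards an arbitrary `v` of the hyperplane. -/
theorem isWall_of_window_sub_eq {n : ℕ} [Fact (2 < n)] (w : affineSymm n) {i j : Fin n}
    (hij : i ≠ j) {k : ℤ} (h : window w⁻¹ j - window w⁻¹ i = n * k + 1) :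
    IsWall (alcove w) (root i j) k := by
  have hn0 : 2 < n := Fact.out
  have hn : (0 : ℝ) < n := by exact_mod_cast (by omega : 0 < n)
  have hX : window w⁻¹ j - 1 = window w⁻¹ i + n * k := by omega
  have hXj : ∀ (v : EuclideanSpace ℝ (Fin n)) (q : ℤ),
      extend v (w.1 (window w⁻¹ j + n * q)) = v j - q := fun v q => extend_apply_window w v j q
  have hXi : ∀ (v : EuclideanSpace ℝ (Fin n)) (q : ℤ),
      extend v (w.1 (window w⁻¹ j - 1 + n * q)) = v i - k - q := fun v q => by
    rw [hX, add_assoc, ← mul_add, extend_apply_window]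
    push_cast
    ring
  refine ⟨Or.inl fun v hv => ?_, (affineSpan_subset_hyperplane _ _ Set.inter_subset_right).antisymm
    fun v hv => ?_⟩
  · obtain ⟨hV, hv⟩ := (mem_alcove_iff w v).1 hv
    refine ⟨hV, ?_⟩
    have := hv (show window w⁻¹ j - 1 + n * 0 ≤ window w⁻¹ j + n * 0 by omega)
    simp only [hXj, hXi] at this
    rw [inner_root]
    linarith
  obtain ⟨hvV, hvk⟩ := (mem_hyperplane_root_iff i j k v).1 hv
  -- `p` lies in the relative interior of the facet.
  set p : EuclideanSpace ℝ (Fin n) := centre w - (1 / (2 * n) : ℝ) • root i j with hp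
  have hpV : p ∈ V n := (V n).sub_mem (centre_mem_V w) ((V n).smul_mem _ (root_mem_V i j))
  -- The centre pairs to `k + 1 / n`; subtracting `1 / (2 n)` times the root lowers this by exactly
  -- `1 / n`.
  have hpk : p i - p j = k := by
    have h1 : ((window w⁻¹ j : ℤ) : ℝ) - window w⁻¹ i = n * k + 1 := by exact_mod_cast h
    simp only [hp, PiLp.sub_apply, PiLp.smul_apply, centre_apply, root_apply, if_pos, if_neg hij,
      if_neg hij.symm, smul_eq_mul]
    field_simp
    linarith
  -- Away from the tight pair the slack `1 / n` of the centre survives: coordinate `i` was lowered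
  -- and would hurt only as the left neighbour, coordinate `j` was raised and would hurt only as the
  -- right one, and both happen only at the tight pair.
  have hgap : ∀ x : ℤ, res n (w.1 (x + 1)) ≠ j →
      extend p (w.1 (x + 1)) + 1 / n ≤ extend p (w.1 x) := by
    intro x hx
    have hx' : res n (w.1 x) ≠ i := by
      rw [Ne, res_apply_eq_iff] at hx ⊢
      rintro ⟨q, rfl⟩
      exact hx ⟨q - k, by rw [mul_sub]; omega⟩
    have e1 : ∀ y, extend p y = extend (centre w) y - 1 / (2 * n) * root i j (res n y) :=
        fun y => by
      simp only [extend, hp, PiLp.sub_apply, PiLp.smul_apply, smul_eq_mul]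
      ring
    rw [e1, e1, extend_centre, extend_centre, Equiv.symm_apply_apply, Equiv.symm_apply_apply,
      root_apply, root_apply, if_neg hx, if_neg hx']
    have h2 : (0 : ℝ) < 1 / (2 * n) := by positivity
    have h3 : (((n : ℝ) - 1) / 2 - ((x + 1 : ℤ) : ℝ)) / n + 1 / n
        = (((n : ℝ) - 1) / 2 - (x : ℝ)) / n := by
      push_cast; field_simp; ring
    split_ifs <;> linarith
  -- The increments are periodic, so the sum of their absolute values over one period bounds them
  -- all.
  obtain ⟨M, hM0, hM⟩ : ∃ M : ℝ, 0 ≤ M ∧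
      ∀ x : ℤ, extend v (w.1 (x + 1)) - extend v (w.1 x) ≤ M := by
    have hper : Function.Periodic (fun x => extend v (w.1 (x + 1)) - extend v (w.1 x)) (n : ℤ) :=
      fun x => by
        simp only [add_right_comm x (n : ℤ) 1, affineSymm_add, extend_add_natCast]
        ring
    refine ⟨∑ x : Fin n, |extend v (w.1 ((x : ℕ) + 1)) - extend v (w.1 (x : ℕ))|,
      Finset.sum_nonneg fun _ _ => abs_nonneg _, fun x => ?_⟩
    refine (periodic_res hper x).symm.trans_le ((le_abs_self _).trans ?_)
    exact Finset.single_le_sum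
      (f := fun x : Fin n => |extend v (w.1 ((x : ℕ) + 1)) - extend v (w.1 (x : ℕ))|)
      (fun _ _ => abs_nonneg _) (Finset.mem_univ (res n x))
  -- The solution of `(1 - t) / n = t * M`: the slack kept from `p` just pays for the worst rise of
  -- `v`.
  set t : ℝ := 1 / (1 + n * M) with ht
  have hden : 0 < 1 + n * M := by positivity
  have ht0 : 0 < t := by positivity
  have ht1 : (1 - t) * (1 / n) = t * M := by
    rw [ht]; field_simp; ring
  have ht2 : 0 ≤ 1 - t := by
    have : (1 - t) * (1 / n) * n = 1 - t := by field_simp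
    rw [← this, ht1]
    positivity
  have hmem : ∀ t : ℝ, 0 ≤ t → 0 ≤ 1 - t → t * M ≤ (1 - t) * (1 / n) →
      AffineMap.lineMap p v t ∈ alcove w ∩ hyperplane (root i j) k := by
    intro t ht0 ht1 ht
    set q : EuclideanSpace ℝ (Fin n) := AffineMap.lineMap p v t with hq
    have hqH : q ∈ hyperplane (root i j) k := by
      rw [mem_hyperplane_root_iff, hq, AffineMap.lineMap_apply_module]
      refine ⟨(V n).add_mem ((V n).smul_mem _ hpV) ((V n).smul_mem _ hvV), ?_⟩
      simp only [PiLp.add_apply, PiLp.smul_apply, smul_eq_mul]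
      linear_combination (1 - t) * hpk + t * hvk
    refine ⟨(mem_alcove_iff w q).2 ⟨hqH.1, antitone_int_of_succ_le fun x => ?_⟩, hqH⟩
    by_cases hx : res n (w.1 (x + 1)) = j
    · obtain ⟨c, hc⟩ := (res_apply_eq_iff w _ _).1 hx
      have e : x = window w⁻¹ j - 1 + n * c := by omega
      rw [hc, hXj, e, hXi]
      have := ((mem_hyperplane_root_iff i j k q).1 hqH).2
      linarith
    · have h1 := mul_le_mul_of_nonneg_left (hgap x hx) ht1
      have h2 := mul_le_mul_of_nonneg_left (hM x) ht0
      rw [hq, extend_lineMap, extend_lineMap]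
      simp only [AffineMap.lineMap_apply_module, smul_eq_mul]
      linarith
  have hp0 := hmem 0 le_rfl (by norm_num) (by rw [zero_mul]; positivity)
  rw [AffineMap.lineMap_apply_zero] at hp0
  -- Stretching the segment from `p` to the nearby face point by `1 / t` recovers `v`.
  have hline := AffineMap.lineMap_mem (1 / t) (subset_affineSpan ℝ _ hp0)
    (subset_affineSpan ℝ _ (hmem t ht0.le ht2 ht1.ge))
  rwa [AffineMap.lineMap_lineMap_right, one_div_mul_cancel ht0.ne',
    AffineMap.lineMap_apply_one] at hline

/-- Otherwise position `X j - 1 = X m + n c` lies strictly between `X i + n k` and `X j`, and the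
face also satisfies `u_m - u_j = c`, which fails on the hyperplane. -/
theorem window_sub_eq_of_isWall {n : ℕ} [Fact (2 < n)] (w : affineSymm n) {i j : Fin n}
    (hij : i ≠ j) {k : ℤ} (h1 : n * k < window w⁻¹ j - window w⁻¹ i)
    (h2 : window w⁻¹ j - window w⁻¹ i < n * (k + 1)) (hwall : IsWall (alcove w) (root i j) k) :
    window w⁻¹ j - window w⁻¹ i = n * k + 1 := by
  have hn0 : 2 < n := Fact.out
  by_contra hne
  rw [mul_add, mul_one] at h2
  obtain ⟨m, hm⟩ : ∃ m, res n (w.1 (window w⁻¹ j - 1)) = m := ⟨_, rfl⟩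
  obtain ⟨c, hc⟩ := (res_apply_eq_iff w _ _).1 hm
  have hmj : m ≠ j := by
    rintro rfl
    have h3 : (n : ℤ) * (-c) = 1 := by linarith
    have := Int.eq_one_or_neg_one_of_mul_eq_one h3
    omega
  -- If `m = i`, the bounds on `X j - X i` leave only `c = k`, the excluded adjacent case.
  have hmi : m ≠ i := by
    rintro rfl
    have h3 : k ≤ c := by
      by_contra h3
      have : (n : ℤ) * c ≤ n * k := mul_le_mul_of_nonneg_left (by omega) (by omega)
      omega
    have h4 : (n : ℤ) * c < n * (k + 1) := by rw [mul_add]; omega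
    have h5 : c < k + 1 := lt_of_mul_lt_mul_left h4 (by omega)
    obtain rfl : c = k := by omega
    omega
  -- The value at the middle position is squeezed between two equal values.
  have hfacet : ∀ u ∈ alcove w ∩ hyperplane (root i j) k, u m - u j = c := by
    rintro u ⟨hu, huH⟩
    have h3 := ((mem_alcove_iff w u).1 hu).2
    have h4 := h3 (show window w⁻¹ i + n * k ≤ window w⁻¹ m + n * c by omega)
    have h5 := h3 (show window w⁻¹ m + n * c ≤ window w⁻¹ j + n * 0 by omega)
    simp only [extend_apply_window] at h4 h5
    have h6 := ((mem_hyperplane_root_iff i j k u).1 huH).2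
    push_cast at h5
    linarith
  have hspan : ∀ u ∈ hyperplane (root i j) k, u m - u j = c := by
    intro u hu
    rw [← hwall.2] at hu
    refine affineSpan_induction (p := fun u => u m - u j = (c : ℝ)) hu hfacet fun a x y z hx hy hz => ?_
    simp only [vsub_eq_sub, vadd_eq_add, PiLp.add_apply, PiLp.smul_apply, PiLp.sub_apply,
      smul_eq_mul]
    linear_combination a * hx - a * hy + hz
  have e1 := hspan ((k / 2 : ℝ) • root i j) <| by
    rw [mem_hyperplane_root_iff]
    refine ⟨(V n).smul_mem _ (root_mem_V i j), ?_⟩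
    simp [root_apply, hij, hij.symm]
  -- The added vector `2 ε_m - ε_i - ε_j` keeps `u_i - u_j` but raises `u_m - u_j` by 3, so both
  -- points cannot satisfy the extra equation.
  have e2 := hspan ((k / 2 : ℝ) • root i j + (root m i + root m j)) <| by
    rw [mem_hyperplane_root_iff]
    refine ⟨(V n).add_mem ((V n).smul_mem _ (root_mem_V i j))
      ((V n).add_mem (root_mem_V m i) (root_mem_V m j)), ?_⟩
    simp [root_apply, hij, hij.symm, hmi.symm, hmj.symm]
  simp [root_apply, hij.symm, hmi, hmj, hmj.symm] at e1 e2
  linarith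

end AffineCore

theorem mainTheorem8 (n : ℕ) [Fact (2 < n)] (w : affineSymm n)
    (hdom : alcove w ⊆ dominantChamber n) (i j : Fin n) (hij : i < j) (k : ℤ)
    (hk : alcove w ⊆ halfPos (root i j) k ∩ halfNeg (root i j) (k + 1))
    (μ : YoungDiagram) (hμ : IsActionOn w⁻¹ ⊥ μ) :
    (n * k < window w⁻¹ j - window w⁻¹ i ∧ window w⁻¹ j - window w⁻¹ i < n * (k + 1)) ∧
    (window w⁻¹ j - window w⁻¹ i = n * k + 1 ↔ IsWall (alcove w) (root i j) k) ∧
    (window w⁻¹ j - window w⁻¹ i = n * (k + 1) - 1 ↔ IsWall (alcove w) (root i j) (k + 1)) ∧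
    nSet μ j - nSet μ i = window w⁻¹ (finPart w j) - window w⁻¹ (finPart w i) := by
  obtain ⟨h1, h2⟩ := window_sub_bounds w hij.ne hk
  have e : (n : ℤ) * -(k + 1) = -(n * (k + 1)) := by ring
  refine ⟨⟨h1, h2⟩, ⟨isWall_of_window_sub_eq w hij.ne, window_sub_eq_of_isWall w hij.ne h1 h2⟩,
    ?_, by rw [nSet_eq_window w hμ, nSet_eq_window w hμ]⟩
  -- The upper wall is the lower-wall statement for `(j, i)` and `-(k + 1)`, since `X i - X j = n *
  -- -(k + 1) + 1` is the asserted equality.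
  rw [isWall_root_swap]
  constructor
  · intro h
    exact isWall_of_window_sub_eq w hij.ne' (by omega)
  · intro h
    have h3 : (n : ℤ) * (-(k + 1) + 1) = -(n * k) := by ring
    have := window_sub_eq_of_isWall w hij.ne' (by omega) (by omega) h
    omega
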